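/- Consider a system $S$ of $m$ bosonic modes with free Hamiltonian $H_S=\sum_{j=1}^m\omega_j\hat a_j^\dagger\hat a_j$, all $\omega_j>0$, and an inverse temperature $\beta>0$. A Gaussian channel is a completely positive trace-preserving linear map $\mathcal E$ on the trace-class operators on Fock space that acts on characteristic functions $\chi_T(\xi)=\operatorname{tr}[T D(\xi)]$, where $\xi\in\mathbb C^m$ and $D(\xi)=\exp\sum_j(\xi_j\hat a_j^\dagger-\overline{\xi_j}\hat a_j)$, as $\chi_{\mathcal E(T)}(\xi)=\chi_T(K\xi)\,e^{-q(\xi)+i\delta(\xi)}$ with $K$ real-linear, $q$ a real quadratic form and $\delta$ a real-linear functional. A Gaussian unitary is a unitary operator $U$ with $UD(\xi)U^\dagger=e^{i\delta(\xi)}D(\mathcal S\xi)$ for a symplectic real-linear map $\mathcal S$ and a real-linear functional $\delta$; it is called passive if it commutes with the free Hamiltonian (equivalently, with $e^{-iHt}$ for all $t\in\mathbb R$). A Gaussian enhanced thermal operation (GEnTO) on $S$ is a Gaussian channel $\mathcal E$ that is covariant, $\mathcal E(e^{-iH_St}\,\cdot\,e^{iH_St})=e^{-iH_St}\mathcal E(\cdot)e^{iH_St}$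 for all $t\in\mathbb R$, and preserves the Gibbs state, $\mathcal E(\gamma_S)=\gamma_S$ with $\gamma_S=e^{-\beta H_S}/\operatorname{tr}[e^{-\beta H_S}]$. A Gaussian thermal operation (GTO) on $S$ is a channel of the form $$\mathcal E(\cdot)=\operatorname{tr}_R\bigl[U(\cdot\otimes\gamma_R)U^\dagger\bigr],\qquad \gamma_R=\frac{e^{-\beta H_R}}{\operatorname{tr}[e^{-\beta H_R}]},$$ where $R$ consists of finitely many bosonic modes with free Hamiltonian $H_R$ and positive frequencies, and $U$ is a passive unitary on $SR$ (Gaussian, with $[U,H_S+H_R]=0$). Then: 1. For every GEnTO $\mathcal E$ on $S$ there are finitely many ancillary modes $R$ of positive frequencies and a passive unitary $U$ on $SR$ such that $\mathcal E(\cdot)=\operatorname{tr}_R[U(\cdot\otimes\gamma_R)U^\dagger]$, with $\gamma_R$ the Gibbs state of $R$ at the same inverse temperature $\beta$. 2. Consequently, a channel on $S$ is a GEnTO if and only if it is a GTO. 3. Every GEnTO $\mathcal E$ on $S$ can be written as $\mathcal E=\mathcal U_L\circ\mathcal E_D\circ\mathcal U_R$, where $\mathcal U_L,\mathcal U_R$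 are the unitary channels of passive unitaries on $S$, and there are a set $J\subseteq\{1,\dots,m\}$ and transmittances $\eta_j\in[0,1)$, $j\in J$, such that $\mathcal E_D$ is realized by mixing, for each $j\in J$, the $j$th system mode, on a beam splitter of transmittance $\eta_j$, with its own ancillary mode, which has frequency $\omega_j$ and is initially in the Gibbs state at inverse temperature $\beta$; the modes outside $J$ are left alone. -/

import Mathlib

open scoped InnerProductSpace ComplexOrder

namespace GaussianThermo

noncomputable section

/-! ## Fock space of finitely many bosonic modes -/

/-- The Hilbert space of the bosonic modes labelled by `ι`, in the occupation number
representation: square-summable functions on the set of occupation numbers `ι → ℕ`. -/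
abbrev Fock (ι : Type) : Type := lp (fun _ : ι → ℕ => ℂ) 2

/-- Bounded operators on Fock space. -/
abbrev Op (ι : Type) : Type := Fock ι →L[ℂ] Fock ι

open Classical in
/-- The number state `|n⟩`. -/
def ket {ι : Type} (n : ι → ℕ) : Fock ι := lp.single 2 n (1 : ℂ)

theorem inner_ket {ι : Type} (n : ι → ℕ) (f : Fock ι) : ⟪ket n, f⟫_ℂ = f n := by
  classical
  simp [ket, lp.inner_single_left]

theorem memlp_two_iff {α : Type} {f : α → ℂ} :
    Memℓp f 2 ↔ Summable fun i => ‖f i‖ ^ 2 := by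
  rw [memℓp_gen_iff (by norm_num)]
  simp

theorem norm_sq_fock {ι : Type} (f : Fock ι) : HasSum (fun n => ‖f n‖ ^ 2) (‖f‖ ^ 2) := by
  have := lp.hasSum_norm (p := 2) (by norm_num) f
  simpa using this

/-- The product vector `ψ ⊗ φ` in the Fock space of the modes `ι ⊕ κ`, which is the tensor product
of the Fock spaces of `ι` and of `κ`. -/
def tmul {ι κ : Type} (ψ : Fock ι) (φ : Fock κ) : Fock (ι ⊕ κ) :=
  ⟨fun n => ψ (n ∘ Sum.inl) * φ (n ∘ Sum.inr), by
    have h := (norm_sq_fock ψ).summable.mul_of_nonneg (norm_sq_fock φ).summable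
      (fun _ => by positivity) (fun _ => by positivity)
    have h2 := (Equiv.sumArrowEquivProdArrow ι κ ℕ).summable_iff.mpr h
    refine memlp_two_iff.mpr (h2.congr fun n => ?_)
    simp [mul_pow, Equiv.sumArrowEquivProdArrow]⟩

/-- The bounded operator `P` is the tensor product `A ⊗ B`. -/
def IsTensor {ι κ : Type} (P : Op (ι ⊕ κ)) (A : Op ι) (B : Op κ) : Prop :=
  ∀ (ψ : Fock ι) (φ : Fock κ), P (tmul ψ φ) = tmul (A ψ) (B φ)

/-- The operator `Q` on the modes `ι` is the partial trace over the modes `κ` of `P`. -/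
def IsPartialTrace {ι κ : Type} (P : Op (ι ⊕ κ)) (Q : Op ι) : Prop :=
  ∀ ψ φ : Fock ι, HasSum (fun k : κ → ℕ => ⟪tmul ψ (ket k), P (tmul φ (ket k))⟫_ℂ) ⟪ψ, Q φ⟫_ℂ

/-! ## Trace-class operators and quantum channels -/

/-- The trace, `∑ₙ ⟨n|T|n⟩`; the series converges absolutely for trace-class `T`. -/
def trace {ι : Type} (T : Op ι) : ℂ := ∑' n : ι → ℕ, ⟪ket n, T (ket n)⟫_ℂ

/-- The trace-class operators: those that are sums `∑ᵢ |uᵢ⟩⟨vᵢ|` with `∑ᵢ ‖uᵢ‖ ‖vᵢ‖ < ∞`. -/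
def traceClass (ι : Type) : Submodule ℂ (Op ι) where
  carrier := {T | ∃ (I : Type) (u v : I → Fock ι), Summable (fun i => ‖u i‖ * ‖v i‖) ∧
    ∀ x, HasSum (fun i => ⟪v i, x⟫_ℂ • u i) (T x)}
  zero_mem' := ⟨Empty, Empty.elim, Empty.elim, summable_empty, fun x => by simp⟩
  add_mem' := by
    rintro S T ⟨I, u, v, hs, h⟩ ⟨J, u', v', hs', h'⟩
    refine ⟨I ⊕ J, Sum.elim u u', Sum.elim v v', ?_, fun x => ?_⟩
    · exact (HasSum.sum (f := fun i => ‖Sum.elim u u' i‖ * ‖Sum.elim v v' i‖)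
        hs.hasSum hs'.hasSum).summable
    · exact HasSum.sum (f := fun i => ⟪Sum.elim v v' i, x⟫_ℂ • Sum.elim u u' i) (h x) (h' x)
  smul_mem' := by
    rintro c T ⟨I, u, v, hs, h⟩
    refine ⟨I, fun i => c • u i, v, ?_, fun x => ?_⟩
    · simpa [norm_smul, mul_assoc] using hs.mul_left ‖c‖
    · simpa [smul_smul, mul_comm] using (h x).const_smul c

theorem conj_mem_traceClass {ι : Type} (U : Op ι) {T : Op ι} (hT : T ∈ traceClass ι) :
    U * T * star U ∈ traceClass ι := by
  obtain ⟨I, u, v, hs, h⟩ := hT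
  refine ⟨I, fun i => U (u i), fun i => U (v i), ?_, fun x => ?_⟩
  · refine Summable.of_nonneg_of_le (fun i => by positivity) (fun i => ?_)
      (hs.mul_left (‖U‖ * ‖U‖))
    calc ‖U (u i)‖ * ‖U (v i)‖ ≤ (‖U‖ * ‖u i‖) * (‖U‖ * ‖v i‖) := by
          gcongr <;> exact U.le_opNorm _
      _ = ‖U‖ * ‖U‖ * (‖u i‖ * ‖v i‖) := by ring
  · have := (h (star U x)).mapL U
    simpa [ContinuousLinearMap.star_eq_adjoint, ContinuousLinearMap.adjoint_inner_right] using this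

/-- The map `T ↦ U T U†` on trace-class operators. -/
def conj {ι : Type} (U : Op ι) (T : traceClass ι) : traceClass ι :=
  ⟨U * T.1 * star U, conj_mem_traceClass U T.2⟩

/-- Positivity of the block operator `(Tᵢⱼ)` on `(Fock ι)ᵏ = Fock ι ⊗ ℂᵏ`. -/
def BlockPositive {ι : Type} {k : ℕ} (T : Fin k → Fin k → Op ι) : Prop :=
  ∀ v : Fin k → Fock ι, 0 ≤ ∑ i, ∑ j, ⟪v i, T i j (v j)⟫_ℂ

/-- Quantum channels in the Schrödinger picture: linear, completely positive, trace-preserving maps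
on trace-class operators. -/
structure Channel (ι κ : Type) where
  map : traceClass ι →ₗ[ℂ] traceClass κ
  completelyPositive : ∀ (k : ℕ) (T : Fin k → Fin k → traceClass ι),
    BlockPositive (fun i j => (T i j : Op ι)) → BlockPositive (fun i j => (map (T i j) : Op κ))
  tracePreserving : ∀ T : traceClass ι, trace (map T : Op κ) = trace (T : Op ι)

/-! ## Free Hamiltonian, time translation and Gibbs states -/

section Diagonal

variable {ι : Type}

theorem memlp_mul {c : (ι → ℕ) → ℂ} {C : ℝ} (h : ∀ n, ‖c n‖ ≤ C) (f : Fock ι) :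
    Memℓp (fun n => c n * f n) 2 := by
  refine memlp_two_iff.mpr (Summable.of_nonneg_of_le (fun _ => by positivity) (fun n => ?_)
    ((norm_sq_fock f).summable.mul_left (C ^ 2)))
  rw [norm_mul, mul_pow]
  gcongr
  exact h n

open Classical in
/-- The operator that is diagonal in the number basis, with bounded eigenvalues `c n`
(and `0` by convention if `c` is unbounded). -/
def diagonal (c : (ι → ℕ) → ℂ) : Op ι :=
  if h : ∃ C : ℝ, ∀ n, ‖c n‖ ≤ C then
    LinearMap.mkContinuousOfExistsBound
      { toFun := fun f => (⟨fun n => c n * f n, memlp_mul h.choose_spec f⟩ : Fock ι)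
        map_add' := fun f g => by ext n; exact mul_add _ _ _
        map_smul' := fun a f => by ext n; exact mul_left_comm _ _ _ }
      ⟨h.choose, fun f => by
        have h0 : 0 ≤ h.choose := (norm_nonneg _).trans (h.choose_spec 0)
        refine le_of_sq_le_sq ?_ (by positivity)
        rw [mul_pow]
        refine hasSum_le (fun n => ?_) (norm_sq_fock _) ((norm_sq_fock f).mul_left _)
        change ‖c n * f n‖ ^ 2 ≤ _
        rw [norm_mul, mul_pow]
        gcongr
        exact h.choose_spec n⟩
  else 0

theorem diagonal_apply {c : (ι → ℕ) → ℂ} (h : ∃ C : ℝ, ∀ n, ‖c n‖ ≤ C) (f : Fock ι) (n : ι → ℕ) :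
    diagonal c f n = c n * f n := by
  rw [diagonal, dif_pos h]
  rfl

theorem diagonal_ket {c : (ι → ℕ) → ℂ} (h : ∃ C : ℝ, ∀ n, ‖c n‖ ≤ C) (n : ι → ℕ) :
    diagonal c (ket n) = c n • ket n := by
  classical
  ext k
  rw [diagonal_apply h]
  by_cases hk : k = n
  · subst hk; rfl
  · simp [ket, hk]

end Diagonal

section Modes

variable {ι κ : Type} [Fintype ι] [Fintype κ]

/-- The eigenvalue of the free Hamiltonian `∑ⱼ ωⱼ aⱼ† aⱼ` at the number state `|n⟩`. -/
def energy (ω : ι → ℝ) (n : ι → ℕ) : ℝ := ∑ j, ω j * n j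

/-- Time translation `e^{-iHt}` under the free Hamiltonian. -/
def evolution (ω : ι → ℝ) (t : ℝ) : Op ι :=
  diagonal fun n => Complex.exp (-(Complex.I * t * energy ω n))

/-- The operator `e^{-βH}`. -/
def boltzmann (ω : ι → ℝ) (β : ℝ) : Op ι :=
  diagonal fun n => (Real.exp (-(β * energy ω n)) : ℂ)

/-- The Gibbs state `e^{-βH} / tr e^{-βH}`. -/
def gibbs (ω : ι → ℝ) (β : ℝ) : Op ι := (trace (boltzmann ω β))⁻¹ • boltzmann ω β

theorem energy_nonneg {ω : ι → ℝ} (hω : ∀ j, 0 < ω j) (n : ι → ℕ) : 0 ≤ energy ω n :=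
  Finset.sum_nonneg fun j _ => mul_nonneg (hω j).le (Nat.cast_nonneg _)

theorem evolution_ket (ω : ι → ℝ) (t : ℝ) (n : ι → ℕ) :
    evolution ω t (ket n) = Complex.exp (-(Complex.I * t * energy ω n)) • ket n := by
  refine diagonal_ket ⟨1, fun k => le_of_eq ?_⟩ n
  rw [Complex.norm_exp]
  simp

theorem boltzmann_ket {ω : ι → ℝ} (hω : ∀ j, 0 < ω j) {β : ℝ} (hβ : 0 < β) (n : ι → ℕ) :
    boltzmann ω β (ket n) = (Real.exp (-(β * energy ω n)) : ℂ) • ket n := by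
  refine diagonal_ket ⟨1, fun k => ?_⟩ n
  rw [Complex.norm_real, Real.norm_eq_abs, Real.abs_exp, Real.exp_le_one_iff]
  have := mul_nonneg hβ.le (energy_nonneg hω k)
  linarith

/-! ## Displacement operators -/

theorem summable_prod {g : ι → ℕ → ℝ} (h0 : ∀ j k, 0 ≤ g j k) (hg : ∀ j, Summable (g j)) :
    Summable fun n : ι → ℕ => ∏ j, g j (n j) := by
  classical
  refine summable_of_sum_le (c := ∏ j, ∑' k, g j k)
    (fun n => Finset.prod_nonneg fun j _ => h0 j _) fun s => ?_
  calc ∑ n ∈ s, ∏ j, g j (n j)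
      ≤ ∑ n ∈ Fintype.piFinset (fun j => s.image (fun n => n j)), ∏ j, g j (n j) := by
        refine Finset.sum_le_sum_of_subset_of_nonneg (fun n hn => ?_)
          (fun n _ _ => Finset.prod_nonneg fun j _ => h0 j _)
        exact Fintype.mem_piFinset.mpr fun j => Finset.mem_image_of_mem _ hn
    _ = ∏ j, ∑ k ∈ s.image (fun n => n j), g j k := (Finset.prod_univ_sum _ _).symm
    _ ≤ ∏ j, ∑' k, g j k :=
        Finset.prod_le_prod (fun j _ => Finset.sum_nonneg fun k _ => h0 j k)
          (fun j _ => (hg j).sum_le_tsum _ fun k _ => h0 j k)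

/-- The unnormalised coherent vector `∑ₙ ∏ⱼ zⱼ ^ nⱼ / √(nⱼ!) |n⟩ = exp (∑ⱼ zⱼ aⱼ†) |0⟩`. -/
def expVec (z : ι → ℂ) : Fock ι :=
  ⟨fun n => ∏ j, z j ^ n j / (Real.sqrt (n j).factorial : ℂ), by
    refine memlp_two_iff.mpr ((summable_prod
      (g := fun j k => (‖z j‖ ^ 2) ^ k / (k.factorial : ℝ)) (fun j k => by positivity)
      (fun j => Real.summable_pow_div_factorial _)).congr fun n => ?_)
    rw [norm_prod, ← Finset.prod_pow]
    refine Finset.prod_congr rfl fun j _ => ?_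
    rw [norm_div, norm_pow, Complex.norm_real, Real.norm_of_nonneg (Real.sqrt_nonneg _), div_pow,
      Real.sq_sqrt (Nat.cast_nonneg _), ← pow_mul, ← pow_mul, mul_comm]⟩

/-- The displacement (Weyl) operator `D(ξ) = exp (∑ⱼ (ξⱼ aⱼ† - conj ξⱼ aⱼ))`, given by its action
`D(ξ) e(z) = exp (-|ξ|²/2 - ⟨ξ, z⟩) e(z + ξ)` on the coherent vectors `e(z) = exp (z · a†) |0⟩`,
whose span is dense; see `displacement_expVec`. -/
def displacement (ξ : ι → ℂ) : Op ι :=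
  (Finsupp.linearCombination ℂ fun z : ι → ℂ =>
    Complex.exp (-((∑ j, ‖ξ j‖ ^ 2 : ℝ) : ℂ) / 2 - ∑ j, star (ξ j) * z j) •
      expVec (z + ξ)).extendOfNorm (Finsupp.linearCombination ℂ (expVec (ι := ι)))

theorem hasSum_prod {g : ι → ℕ → ℂ} (hg : ∀ j, Summable fun k => ‖g j k‖) :
    HasSum (fun n : ι → ℕ => ∏ j, g j (n j)) (∏ j, ∑' k, g j k) := by
  classical
  have hs : Summable fun n : ι → ℕ => ∏ j, g j (n j) := by
    refine Summable.of_norm ?_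
    simpa only [norm_prod] using summable_prod (fun j k => norm_nonneg (g j k)) hg
  have hf : Filter.Tendsto (fun N : ℕ => Fintype.piFinset fun _ : ι => Finset.range N)
      Filter.atTop Filter.atTop := by
    refine Filter.tendsto_atTop_finset_of_monotone (fun a b hab => ?_) fun n => ?_
    · exact Fintype.piFinset_subset _ _ fun _ => Finset.range_subset_range.mpr hab
    · refine ⟨∑ j, n j + 1, Fintype.mem_piFinset.mpr fun j => Finset.mem_range.mpr ?_⟩
      exact Nat.lt_succ_of_le (Finset.single_le_sum (fun i _ => Nat.zero_le (n i))
        (Finset.mem_univ j))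
  have h1 := hs.hasSum.comp hf
  have h2 : Filter.Tendsto (fun N : ℕ => ∏ j, ∑ k ∈ Finset.range N, g j k) Filter.atTop
      (nhds (∏ j, ∑' k, g j k)) :=
    tendsto_finsetProd _ fun j _ => (hg j).of_norm.hasSum.tendsto_sum_nat
  have h3 := tendsto_nhds_unique h1 (h2.congr fun N => Finset.prod_univ_sum _ _)
  rw [← h3]
  exact hs.hasSum

theorem inner_expVec (z w : ι → ℂ) :
    ⟪expVec z, expVec w⟫_ℂ = Complex.exp (∑ j, star (z j) * w j) := by
  have hg : ∀ j, Summable fun k : ℕ => ‖(star (z j) * w j) ^ k / (k.factorial : ℂ)‖ := by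
    intro j
    simpa using Real.summable_pow_div_factorial ‖star (z j) * w j‖
  have h := hasSum_prod hg
  have h2 : ∏ j, ∑' k : ℕ, (star (z j) * w j) ^ k / (k.factorial : ℂ)
      = Complex.exp (∑ j, star (z j) * w j) := by
    rw [Complex.exp_sum]
    refine Finset.prod_congr rfl fun j _ => ?_
    rw [Complex.exp_eq_exp_ℂ, NormedSpace.exp_eq_tsum_div]
  rw [h2] at h
  refine (lp.hasSum_inner (expVec z) (expVec w)).unique (h.congr_fun fun n => ?_)
  change (∏ j, w j ^ n j / (Real.sqrt (n j).factorial : ℂ)) *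
    star (∏ j, z j ^ n j / (Real.sqrt (n j).factorial : ℂ)) = _
  rw [star_prod, ← Finset.prod_mul_distrib]
  refine Finset.prod_congr rfl fun j _ => ?_
  have hq : (Real.sqrt (n j).factorial : ℂ) * Real.sqrt (n j).factorial = (n j).factorial := by
    rw [← Complex.ofReal_mul, Real.mul_self_sqrt (Nat.cast_nonneg _)]
    simp
  simp only [star_div₀, star_pow, Complex.star_def, Complex.conj_ofReal]
  rw [div_mul_div_comm, hq, mul_pow, mul_comm]

theorem sum_range_root_pow {N : ℕ} {ζ : ℂ} (hζ : IsPrimitiveRoot ζ N) (a : ℕ) :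
    ∑ p ∈ Finset.range N, (ζ ^ p) ^ a = if N ∣ a then (N : ℂ) else 0 := by
  have h : ∀ p, (ζ ^ p) ^ a = (ζ ^ a) ^ p := fun p => by rw [← pow_mul, ← pow_mul, mul_comm]
  simp only [h]
  split_ifs with ha
  · simp [(hζ.pow_eq_one_iff_dvd a).mpr ha]
  · have h1 : ζ ^ a ≠ 1 := fun h => ha ((hζ.pow_eq_one_iff_dvd a).mp h)
    have h2 := geom_sum_mul (ζ ^ a) N
    rw [← pow_mul, mul_comm a N, pow_mul, hζ.pow_eq_one, one_pow, sub_self] at h2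
    exact (mul_eq_zero.mp h2).resolve_right (sub_ne_zero.mpr h1)

theorem eq_zero_of_inner_expVec {f : Fock ι} (hf : ∀ z, ⟪f, expVec z⟫_ℂ = 0) : f = 0 := by
  classical
  ext n
  set w : (ι → ℕ) → ℂ := fun k => ∏ j, (1 : ℂ) / (Real.sqrt (k j).factorial : ℂ) with hw
  have hw1 : ∀ k, w k = expVec (fun _ : ι => (1 : ℂ)) k := fun k => by simp [hw, expVec]
  have hsum : Summable fun k => ‖f k‖ * ‖w k‖ := by
    refine Summable.of_nonneg_of_le (fun _ => by positivity) (fun k => ?_)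
      ((norm_sq_fock f).summable.add (norm_sq_fock (expVec fun _ : ι => (1 : ℂ))).summable)
    rw [hw1]
    nlinarith [sq_nonneg (‖f k‖ - ‖expVec (fun _ : ι => (1 : ℂ)) k‖),
      sq_nonneg ‖f k‖, sq_nonneg ‖expVec (fun _ : ι => (1 : ℂ)) k‖]
  let D : ℕ → (ι → ℕ) → ℂ := fun N k =>
    if ∀ j, N ∣ (N - 1) * n j + k j then star (f k) * w k else 0
  have key : ∀ N : ℕ, 0 < N → HasSum (D N) 0 := by
    intro N hN
    have hζ := Complex.isPrimitiveRoot_exp N hN.ne'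
    set ζ := Complex.exp (2 * Real.pi * Complex.I / N)
    have h1 : HasSum (fun k => ∑ p ∈ Fintype.piFinset fun _ : ι => Finset.range N,
        (∏ j, (ζ ^ p j) ^ ((N - 1) * n j)) * ⟪f k, expVec (fun j => ζ ^ p j) k⟫_ℂ) 0 := by
      have h0 : (0 : ℂ) = ∑ p ∈ Fintype.piFinset fun _ : ι => Finset.range N,
        (∏ j, (ζ ^ p j) ^ ((N - 1) * n j)) * ⟪f, expVec (fun j => ζ ^ p j)⟫_ℂ := by simp [hf]
      rw [h0]
      refine hasSum_sum fun p _ => HasSum.mul_left _ ?_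
      exact lp.hasSum_inner f (expVec fun j => ζ ^ p j)
    have hNm : ((N : ℂ) ^ Fintype.card ι) ≠ 0 := pow_ne_zero _ (by exact_mod_cast hN.ne')
    have h2 := h1.mul_left ((N : ℂ) ^ Fintype.card ι)⁻¹
    rw [mul_zero] at h2
    refine h2.congr_fun fun k => ?_
    have h3 : ∀ p : ι → ℕ, (∏ j, (ζ ^ p j) ^ ((N - 1) * n j)) *
        ⟪f k, expVec (fun j => ζ ^ p j) k⟫_ℂ =
        star (f k) * w k * ∏ j, (ζ ^ p j) ^ ((N - 1) * n j + k j) := by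
      intro p
      change _ * ((∏ j, (ζ ^ p j) ^ k j / (Real.sqrt (k j).factorial : ℂ)) * star (f k)) = _
      simp only [div_eq_mul_one_div (_ ^ _), Finset.prod_mul_distrib, pow_add, hw]
      ring
    simp only [h3, ← Finset.mul_sum]
    rw [← Finset.prod_univ_sum (fun _ : ι => Finset.range N)
      (fun j p => (ζ ^ p) ^ ((N - 1) * n j + k j))]
    simp only [sum_range_root_pow hζ, D]
    split_ifs with hd
    · simp only [hd, if_true, Finset.prod_const, Finset.card_univ]
      field_simp
    · push Not at hd
      obtain ⟨j, hj⟩ := hd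
      rw [Finset.prod_eq_zero (Finset.mem_univ j) (by simp [hj])]
      simp
  have hlim : Filter.Tendsto (fun N => ∑' k, D N k) Filter.atTop
      (nhds (∑' k, if k = n then star (f k) * w k else 0)) := by
    refine tendsto_tsum_of_dominated_convergence hsum (fun k => ?_) ?_
    · refine tendsto_const_nhds.congr' ?_
      filter_upwards [Filter.eventually_gt_atTop (∑ j, (n j + k j))] with N hN
      have hNj : ∀ j, n j + k j < N := fun j =>
        (Finset.single_le_sum (f := fun j => n j + k j) (fun i _ => Nat.zero_le _)
          (Finset.mem_univ j)).trans_lt hN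
      have hiff : (∀ j, N ∣ (N - 1) * n j + k j) ↔ k = n := by
        have hmod : ∀ j, N ∣ (N - 1) * n j + k j ↔ k j = n j := by
          intro j
          obtain ⟨M, rfl⟩ : ∃ M, N = M + 1 := ⟨N - 1, by have := hNj j; omega⟩
          have h5 := hNj j
          have h6 : (M + 1 - 1) * n j + k j + n j = (M + 1) * n j + k j := by
            simp only [Nat.add_sub_cancel]; ring
          constructor
          · intro hd
            have h7 : (M + 1) * n j + k j ≡ n j [MOD M + 1] := by
              rw [← h6]
              simpa using ((Nat.modEq_zero_iff_dvd.mpr hd).add_right (n j))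
            have h8 : k j ≡ n j [MOD M + 1] := by
              simpa [Nat.ModEq] using h7
            exact h8.eq_of_lt_of_lt (by omega) (by omega)
          · intro h
            refine ⟨n j, ?_⟩
            rw [h, Nat.add_sub_cancel]; ring
        simp only [hmod, funext_iff]
      simp only [D, hiff]
    · refine Filter.Eventually.of_forall fun N k => ?_
      simp only [D]
      split_ifs
      · rw [norm_mul, norm_star]
      · simpa using mul_nonneg (norm_nonneg (f k)) (norm_nonneg (w k))
  have h0 : Filter.Tendsto (fun N => ∑' k, D N k) Filter.atTop (nhds 0) := by
    refine tendsto_const_nhds.congr' ?_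
    filter_upwards [Filter.eventually_gt_atTop 0] with N hN
    exact (key N hN).tsum_eq.symm
  have h9 := tendsto_nhds_unique hlim h0
  rw [tsum_ite_eq] at h9
  have hwn : w n ≠ 0 := Finset.prod_ne_zero_iff.mpr fun j _ => by
    have := (Nat.factorial_pos (n j))
    simp only [ne_eq, one_div, inv_eq_zero, Complex.ofReal_eq_zero]
    exact (Real.sqrt_pos.mpr (by exact_mod_cast this)).ne'
  have h10 := (mul_eq_zero.mp h9).resolve_right hwn
  simpa using h10

theorem denseRange_expVec :
    DenseRange (Finsupp.linearCombination ℂ (expVec (ι := ι))) := by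
  have h : (Submodule.span ℂ (Set.range (expVec (ι := ι))))ᗮ = ⊥ := by
    refine (Submodule.eq_bot_iff _).mpr fun f hf => eq_zero_of_inner_expVec fun z => ?_
    exact (Submodule.mem_orthogonal' _ _).mp hf _ (Submodule.subset_span ⟨z, rfl⟩)
  have h2 := (Submodule.topologicalClosure_eq_top_iff).mpr h
  rw [← Finsupp.range_linearCombination] at h2
  have h3 := (Submodule.dense_iff_topologicalClosure_eq_top).mpr h2
  rwa [LinearMap.coe_range] at h3

/-- The displacement operator acts on coherent vectors as stated in its definition. -/
theorem displacement_expVec (ξ z : ι → ℂ) :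
    displacement ξ (expVec z) =
      Complex.exp (-((∑ j, ‖ξ j‖ ^ 2 : ℝ) : ℂ) / 2 - ∑ j, star (ξ j) * z j) • expVec (z + ξ) := by
  have hin : ∀ z w : ι → ℂ,
      ⟪Complex.exp (-((∑ j, ‖ξ j‖ ^ 2 : ℝ) : ℂ) / 2 - ∑ j, star (ξ j) * z j) • expVec (z + ξ),
        Complex.exp (-((∑ j, ‖ξ j‖ ^ 2 : ℝ) : ℂ) / 2 - ∑ j, star (ξ j) * w j) • expVec (w + ξ)⟫_ℂ =
      ⟪expVec z, expVec w⟫_ℂ := by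
    intro z w
    have h1 : ((∑ j, ‖ξ j‖ ^ 2 : ℝ) : ℂ) = ∑ j, star (ξ j) * ξ j := by
      push_cast
      refine Finset.sum_congr rfl fun j _ => ?_
      simpa using (Complex.conj_mul' (ξ j)).symm
    have hr : (starRingEnd ℂ) (∑ j, star (ξ j) * ξ j) = ∑ j, star (ξ j) * ξ j := by
      rw [← h1, Complex.conj_ofReal]
    rw [inner_smul_left, inner_smul_right, inner_expVec, inner_expVec, ← Complex.exp_conj,
      ← Complex.exp_add, ← Complex.exp_add, h1]
    congr 1
    simp only [map_sub, map_div₀, map_neg, hr, Complex.conj_ofNat, Pi.add_apply, star_add]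
    simp only [map_sum, map_mul, Complex.star_def, Complex.conj_conj, add_mul, mul_add,
      Finset.sum_add_distrib]
    simp only [mul_comm (ξ _)]
    ring
  have hnorm : ∀ c : (ι → ℂ) →₀ ℂ, ‖Finsupp.linearCombination ℂ (fun z : ι → ℂ =>
      Complex.exp (-((∑ j, ‖ξ j‖ ^ 2 : ℝ) : ℂ) / 2 - ∑ j, star (ξ j) * z j) • expVec (z + ξ)) c‖ =
      ‖Finsupp.linearCombination ℂ (expVec (ι := ι)) c‖ := by
    intro c
    rw [@norm_eq_sqrt_re_inner ℂ, @norm_eq_sqrt_re_inner ℂ]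
    simp only [Finsupp.linearCombination_apply, Finsupp.sum, sum_inner, inner_sum]
    congr 2
    refine Finset.sum_congr rfl fun a _ => Finset.sum_congr rfl fun b _ => ?_
    have h := hin b a
    simp only [inner_smul_left, inner_smul_right] at h ⊢
    linear_combination (c a * (starRingEnd ℂ) (c b)) * h
  have := LinearMap.extendOfNorm_eq denseRange_expVec
    ⟨1, fun c => by rw [hnorm c, one_mul]⟩ (Finsupp.single z 1)
  simpa [displacement] using this

/-! ## Gaussian unitaries and Gaussian channels -/

/-- The characteristic function `ξ ↦ tr (T D(ξ))` of a trace-class operator. -/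
def charFun (T : Op ι) (ξ : ι → ℂ) : ℂ := trace (T * displacement ξ)

/-- Gaussian channels: on characteristic functions they act by a real-linear substitution and by
multiplication with the exponential of a real quadratic form and of an imaginary linear form.
Equivalently, first and second moments transform as `r ↦ X r + d` and `M ↦ X M X† + Y`, where
`K` is the transpose of `X` for the symplectic pairing, `q` is the quadratic form of `Y` (up to the
normalisation) and `δ` is the pairing with `d`; the uncertainty constraint on `(X, Y)` is complete positivity. -/
def IsGaussian (E : Channel ι κ) : Prop :=
  ∃ (K : (κ → ℂ) →ₗ[ℝ] (ι → ℂ)) (q : QuadraticForm ℝ (κ → ℂ)) (δ : (κ → ℂ) →ₗ[ℝ] ℝ),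
    ∀ (T : traceClass ι) (ξ : κ → ℂ),
      charFun (E.map T : Op κ) ξ =
        charFun (T : Op ι) (K ξ) * Complex.exp (-(q ξ : ℂ) + Complex.I * (δ ξ : ℂ))

/-- Gaussian unitaries: unitary operators that map displacement operators to displacement operators
up to a phase, through a symplectic map `S`. -/
def IsGaussianUnitary (U : Op ι) : Prop :=
  U ∈ unitary (Op ι) ∧ ∃ (S : (ι → ℂ) →ₗ[ℝ] (ι → ℂ)) (δ : (ι → ℂ) →ₗ[ℝ] ℝ),
    (∀ ξ η : ι → ℂ, (∑ j, star (S ξ j) * S η j).im = (∑ j, star (ξ j) * η j).im) ∧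
    ∀ ξ : ι → ℂ, U * displacement ξ * star U =
      Complex.exp (Complex.I * (δ ξ : ℂ)) • displacement (S ξ)

/-- Passive (energy-preserving Gaussian) unitaries: Gaussian unitaries that commute with the free
Hamiltonian, that is, with all time translations. -/
def IsPassive (ω : ι → ℝ) (U : Op ι) : Prop :=
  IsGaussianUnitary U ∧ ∀ t : ℝ, U * evolution ω t = evolution ω t * U

/-- Covariance of a channel with respect to time translation. -/
def IsCovariant (ω : ι → ℝ) (ω' : κ → ℝ) (E : Channel ι κ) : Prop :=
  ∀ (t : ℝ) (T : traceClass ι),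
    E.map (conj (evolution ω t) T) = conj (evolution ω' t) (E.map T)

/-- Gaussian covariant operations. -/
def IsGCO (ω : ι → ℝ) (ω' : κ → ℝ) (E : Channel ι κ) : Prop :=
  IsGaussian E ∧ IsCovariant ω ω' E

/-! ## Gaussian enhanced thermal operations and Gaussian thermal operations -/

/-- Gaussian enhanced thermal operations on the system with frequencies `ω` at inverse temperature
`β`: the Gaussian covariant operations that preserve the Gibbs state. -/
def GEnTO (ω : ι → ℝ) (β : ℝ) : Set (Channel ι ι) :=
  {E | IsGCO ω ω E ∧ ∃ γ : traceClass ι, (γ : Op ι) = gibbs ω β ∧ E.map γ = γ}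

/-- The channel `E` on the modes `ι` is `T ↦ tr_κ [U (T ⊗ σ) U†]`. -/
def IsDilation (U : Op (ι ⊕ κ)) (σ : Op κ) (E : Channel ι ι) : Prop :=
  ∀ T : traceClass ι, ∃ P : Op (ι ⊕ κ), IsTensor P T σ ∧
    IsPartialTrace (U * P * star U) (E.map T : Op ι)

/-- Gaussian thermal operations: the channels that can be implemented with an ancilla of finitely
many modes of positive frequencies `ν`, prepared in its Gibbs state at the ambient inverse
temperature `β`, and a passive unitary on system and ancilla. -/
def GTO (ω : ι → ℝ) (β : ℝ) : Set (Channel ι ι) :=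
  {E | ∃ (r : ℕ) (ν : Fin r → ℝ) (U : Op (ι ⊕ Fin r)), (∀ j, 0 < ν j) ∧
    IsPassive (Sum.elim ω ν) U ∧ IsDilation U (gibbs ν β) E}

section Network

variable [DecidableEq ι]

/-- The unitary `U` acts on displacements, hence on the vector of mean amplitudes `⟨aⱼ⟩`, by the
complex matrix `V`. -/
def Implements (U : Op ι) (V : Matrix ι ι ℂ) : Prop :=
  U ∈ unitary (Op ι) ∧ ∀ ξ : ι → ℂ, U * displacement ξ * star U = displacement (V.mulVec ξ)

/-- The beam-splitter matrix that mixes each system mode `j ∈ J` with its own ancilla mode, with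
transmittance `η j`, and leaves the system modes outside `J` alone. -/
def beamSplitter (J : Finset ι) (η : ι → ℝ) : Matrix (ι ⊕ J) (ι ⊕ J) ℂ :=
  Matrix.fromBlocks
    (Matrix.diagonal fun i => if i ∈ J then (Real.sqrt (η i) : ℂ) else 1)
    (Matrix.of fun i j => if i = j.1 then (Real.sqrt (1 - η i) : ℂ) else 0)
    (Matrix.of fun j i => if i = j.1 then -(Real.sqrt (1 - η i) : ℂ) else 0)
    (Matrix.diagonal fun j => (Real.sqrt (η j.1) : ℂ))

/-- `E = 𝒰_L ∘ E_D ∘ 𝒰_R` with passive unitaries `U_L`, `U_R` on the system, where `E_D` mixes, for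
each `j` in a set `J` of system modes, the mode `j` on a beam splitter of transmittance
`η j < 1` with an ancilla mode of the same frequency in the Gibbs state at inverse temperature
`β`. -/
def IsThermalNetwork (ω : ι → ℝ) (β : ℝ) (E : Channel ι ι) : Prop :=
  ∃ (J : Finset ι) (η : ι → ℝ) (U_L U_R : Op ι) (B : Op (ι ⊕ J)) (E_D : Channel ι ι),
    (∀ j ∈ J, 0 ≤ η j ∧ η j < 1) ∧
    IsPassive ω U_L ∧ IsPassive ω U_R ∧
    IsPassive (Sum.elim ω fun j : J => ω j) B ∧ Implements B (beamSplitter J η) ∧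
    IsDilation B (gibbs (fun j : J => ω j) β) E_D ∧
    ∀ T : traceClass ι, E.map T = conj U_L (E_D.map (conj U_R T))

end Network

end Modes

end

end GaussianThermo

/-!
Everything is reduced to characteristic functions. A trace-class operator is determined by its
characteristic function (`eq_of_charFun_eq`), because the projection on the vacuum is a Gaussian
average of displacement operators (`integral_weighted`). The characteristic function of a product
operator factorizes (`IsTensor.charFun_eq`), a partial trace restricts it (`exists_partialTrace`),
the second quantization of a unitary matrix acts on it by substitution (`charFun_conj_secondQuant`),
and for a Gibbs state it is the Gaussian `exp (-∑ⱼ ν(ωⱼ) |ξⱼ|²)` with `ν(x) = coth (β x / 2) / 2`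
(`charFun_gibbs`).

*From thermal operations to enhanced ones.* These rules show that a channel dilated by a Gaussian
unitary and a Gibbs state is Gaussian. Covariance holds because the unitary and the Gibbs state of
the ancilla both commute with time translations. The Gibbs state of the system is fixed because an
operator that commutes with time translations also commutes with the Boltzmann factor of the
composite system (`gibbs_commute`).

*From enhanced operations to thermal ones.* Let the channel act by `χ(ξ) ↦ χ(K ξ) e^{-q(ξ) + iδ(ξ)}`.
Covariance makes `K` commute with the phase rotations of the modes, so that `K` is a complex matrix
that couples only modes of equal frequency (`exists_matrix_of_intertwines`). Preservation of the
Gibbs state forces the factor to be `exp (-(N(ξ) - N(K ξ)))` with `N(ξ) = ∑ⱼ ν(ωⱼ) |ξⱼ|²`. The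
exponent `N(ξ) - N(K ξ)` is nonnegative: the vectors `∑_{k < n} D(k η) |0⟩` are approximate
eigenvectors of `D(η)`, and a positive trace-preserving map cannot raise the modulus of a
characteristic function above the trace (`Channel.nonneg_of_charFun`). Within each frequency sector
`K` has a singular value decomposition `K = A diag(s) B`, and `N(K ξ) ≤ N(ξ)` says that all
`sⱼ ≤ 1` (`exists_svd_of_mem_GEnTO`). Up to the passive unitaries given by `A` and `B`, the channel
thus damps the mode `j` by `sⱼ` and adds the noise `(1 - sⱼ²) ν(ωⱼ)`. A beam splitter of
transmittance `sⱼ²` with a thermal ancilla of frequency `ωⱼ` does the same, and equality of channels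
follows from equality of characteristic functions (`isDilation_secondQuant`).
-/

namespace GaussianThermo

noncomputable section

/-! ### Trace-class operators and the trace -/

section Nuclear

variable {ι κ I J : Type}

/-- `T = ∑ᵢ |uᵢ⟩⟨vᵢ|` with `∑ᵢ ‖uᵢ‖ ‖vᵢ‖ < ∞`, the sum being taken strongly. -/
def IsNuclear (u v : I → Fock ι) (T : Op ι) : Prop :=
  Summable (fun i => ‖u i‖ * ‖v i‖) ∧ ∀ x, HasSum (fun i => ⟪v i, x⟫_ℂ • u i) (T x)

theorem IsNuclear.mem {u v : I → Fock ι} {T : Op ι} (h : IsNuclear u v T) : T ∈ traceClass ι :=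
  ⟨I, u, v, h⟩

theorem exists_isNuclear {T : Op ι} (hT : T ∈ traceClass ι) :
    ∃ (I : Type) (u v : I → Fock ι), IsNuclear u v T := hT

theorem exists_of_summable (u v : I → Fock ι) (h : Summable (fun i => ‖u i‖ * ‖v i‖)) :
    ∃ T, IsNuclear u v T := by
  have hs : Summable fun i => InnerProductSpace.rankOne ℂ (u i) (v i) :=
    Summable.of_norm (by simpa using h)
  refine ⟨∑' i, InnerProductSpace.rankOne ℂ (u i) (v i), h, fun x => ?_⟩
  simpa using hs.hasSum.mapL (ContinuousLinearMap.apply ℂ (Fock ι) x)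

theorem IsNuclear.mul {u v : I → Fock ι} {T : Op ι} (h : IsNuclear u v T) (A B : Op ι) :
    IsNuclear (fun i => A (u i)) (fun i => star B (v i)) (A * T * B) := by
  refine ⟨Summable.of_nonneg_of_le (fun i => by positivity) (fun i => ?_)
      (h.1.mul_left (‖A‖ * ‖star B‖)), fun x => ?_⟩
  · calc ‖A (u i)‖ * ‖star B (v i)‖ ≤ (‖A‖ * ‖u i‖) * (‖star B‖ * ‖v i‖) := by
          gcongr
          · exact A.le_opNorm _
          · exact (star B).le_opNorm _
      _ = ‖A‖ * ‖star B‖ * (‖u i‖ * ‖v i‖) := by ring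
  · have := (h.2 (B x)).mapL A
    simpa [ContinuousLinearMap.star_eq_adjoint, ContinuousLinearMap.adjoint_inner_left] using this

theorem mul_mem_traceClass {T : Op ι} (hT : T ∈ traceClass ι) (A B : Op ι) :
    A * T * B ∈ traceClass ι := by
  obtain ⟨I, u, v, h⟩ := exists_isNuclear hT
  exact (h.mul A B).mem

/-- Parseval's identity in the number basis. -/
theorem hasSum_inner_mul_inner (x y : Fock ι) :
    HasSum (fun n => ⟪x, ket n⟫_ℂ * ⟪ket n, y⟫_ℂ) ⟪x, y⟫_ℂ := by
  refine (lp.hasSum_inner x y).congr_fun fun n => ?_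
  rw [inner_ket, ← inner_conj_symm, inner_ket]
  exact mul_comm _ _

theorem summable_mul_of_hasSum_sq {α : Type} {f g : α → ℝ} {A B : ℝ} (hf : ∀ i, 0 ≤ f i)
    (hg : ∀ i, 0 ≤ g i) (hA : 0 ≤ A) (hB : 0 ≤ B) (hfA : HasSum (fun i => f i ^ 2) (A ^ 2))
    (hgB : HasSum (fun i => g i ^ 2) (B ^ 2)) :
    (Summable fun i => f i * g i) ∧ ∑' i, f i * g i ≤ A * B := by
  obtain ⟨C, -, hC, h⟩ := Real.inner_le_Lp_mul_Lq_hasSum_of_nonneg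
    Real.HolderConjugate.two_two hA hB hf hg (by simpa using hfA) (by simpa using hgB)
  exact ⟨h.summable, h.tsum_eq.trans_le hC⟩

theorem summable_norm_inner_mul_inner (x y : Fock ι) :
    (Summable fun n : ι → ℕ => ‖⟪x, ket n⟫_ℂ * ⟪ket n, y⟫_ℂ‖) ∧
      ∑' n : ι → ℕ, ‖⟪x, ket n⟫_ℂ * ⟪ket n, y⟫_ℂ‖ ≤ ‖x‖ * ‖y‖ := by
  simp only [norm_mul, norm_inner_symm x, inner_ket]
  exact summable_mul_of_hasSum_sq (fun _ => norm_nonneg _) (fun _ => norm_nonneg _)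
    (norm_nonneg _) (norm_nonneg _) (norm_sq_fock x) (norm_sq_fock y)

/-- The diagonal double series of a trace-class operator converges absolutely, so that the trace
can be read off from any nuclear decomposition. -/
theorem IsNuclear.hasSum_prod {u v : I → Fock ι} {T : Op ι} (h : IsNuclear u v T) :
    HasSum (fun p : I × (ι → ℕ) => ⟪v p.1, ket p.2⟫_ℂ * ⟪ket p.2, u p.1⟫_ℂ)
      (∑' i, ⟪v i, u i⟫_ℂ) := by
  have hs : Summable (fun p : I × (ι → ℕ) => ⟪v p.1, ket p.2⟫_ℂ * ⟪ket p.2, u p.1⟫_ℂ) := by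
    refine Summable.of_norm ?_
    refine (summable_prod_of_nonneg (fun _ => norm_nonneg _)).mpr
      ⟨fun i => (summable_norm_inner_mul_inner (v i) (u i)).1, ?_⟩
    refine Summable.of_nonneg_of_le (fun i => tsum_nonneg fun _ => norm_nonneg _) (fun i => ?_) h.1
    rw [mul_comm]
    exact (summable_norm_inner_mul_inner (v i) (u i)).2
  have h2 := hs.hasSum.prod_fiberwise fun i => hasSum_inner_mul_inner (v i) (u i)
  rw [h2.tsum_eq]
  exact hs.hasSum

theorem IsNuclear.hasSum_inner {u v : I → Fock ι} {T : Op ι} (h : IsNuclear u v T)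
    (x : Fock ι) (y : Fock ι) : HasSum (fun i => ⟪v i, x⟫_ℂ * ⟪y, u i⟫_ℂ) ⟪y, T x⟫_ℂ := by
  simpa [inner_smul_right] using (h.2 x).mapL (innerSL ℂ y)

/-- The trace is `∑ᵢ ⟨vᵢ, uᵢ⟩` for every nuclear decomposition. -/
theorem IsNuclear.hasSum_trace {u v : I → Fock ι} {T : Op ι} (h : IsNuclear u v T) :
    HasSum (fun i => ⟪v i, u i⟫_ℂ) (trace T) ∧
      HasSum (fun n => ⟪ket n, T (ket n)⟫_ℂ) (trace T) := by
  have h1 := h.hasSum_prod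
  have h2 : HasSum (fun p : (ι → ℕ) × I => ⟪v p.2, ket p.1⟫_ℂ * ⟪ket p.1, u p.2⟫_ℂ)
      (∑' i, ⟪v i, u i⟫_ℂ) := (Equiv.prodComm (ι → ℕ) I).hasSum_iff.mpr h1
  have h3 := h2.prod_fiberwise fun n => h.hasSum_inner (ket n) (ket n)
  have h4 : trace T = ∑' i, ⟪v i, u i⟫_ℂ := h3.tsum_eq
  rw [h4]
  exact ⟨(h1.prod_fiberwise fun i => hasSum_inner_mul_inner (v i) (u i)).summable.hasSum, h3⟩

theorem hasSum_trace {T : Op ι} (hT : T ∈ traceClass ι) :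
    HasSum (fun n => ⟪ket n, T (ket n)⟫_ℂ) (trace T) := by
  obtain ⟨I, u, v, h⟩ := exists_isNuclear hT
  exact h.hasSum_trace.2

theorem IsNuclear.hasSum_trace_mul {u v : I → Fock ι} {T : Op ι} (h : IsNuclear u v T)
    (A B : Op ι) : HasSum (fun i => ⟪v i, B (A (u i))⟫_ℂ) (trace (A * T * B)) := by
  simpa [ContinuousLinearMap.star_eq_adjoint, ContinuousLinearMap.adjoint_inner_left]
    using (h.mul A B).hasSum_trace.1

theorem IsNuclear.hasSum_trace_mul_right {u v : I → Fock ι} {T : Op ι} (h : IsNuclear u v T)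
    (B : Op ι) : HasSum (fun i => ⟪v i, B (u i)⟫_ℂ) (trace (T * B)) := by
  simpa using h.hasSum_trace_mul 1 B

/-- Cyclicity of the trace. -/
theorem trace_mul_mul {T : Op ι} (hT : T ∈ traceClass ι) (A B : Op ι) :
    trace (A * T * B) = trace (T * (B * A)) := by
  obtain ⟨I, u, v, h⟩ := exists_isNuclear hT
  exact (h.hasSum_trace_mul A B).unique (h.hasSum_trace_mul_right (B * A))

theorem isNuclear_rankOne (x y : Fock ι) :
    IsNuclear (fun _ : Unit => x) (fun _ => y) (InnerProductSpace.rankOne ℂ x y) :=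
  ⟨Summable.of_finite, fun z => hasSum_unique fun _ : Unit => ⟪y, z⟫_ℂ • x⟩

/-- The operator `|x⟩⟨y|` as a trace-class operator. -/
def ketBra (x y : Fock ι) : traceClass ι :=
  ⟨InnerProductSpace.rankOne ℂ x y, (isNuclear_rankOne x y).mem⟩

theorem trace_ketBra_mul (x y : Fock ι) (B : Op ι) :
    trace ((ketBra x y : Op ι) * B) = ⟪y, B x⟫_ℂ :=
  ((isNuclear_rankOne x y).hasSum_trace_mul_right B).unique
    (hasSum_unique fun _ : Unit => ⟪y, B x⟫_ℂ)

/-- `|tr (P U)| ≤ tr P` for a positive trace-class operator `P` and a unitary operator `U`. -/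
theorem norm_trace_mul_le {P U : Op ι} (hP : P ∈ traceClass ι) (hpos : ∀ x, 0 ≤ ⟪x, P x⟫_ℂ)
    (hU : U ∈ unitary (Op ι)) : ‖trace (P * U)‖ ≤ (trace P).re := by
  have hbound : ∀ x y, ‖⟪x, P y⟫_ℂ‖ ≤ 2⁻¹ * ((⟪x, P x⟫_ℂ).re + (⟪y, P y⟫_ℂ).re) := by
    intro x y
    have hsymm : P.toLinearMap.IsSymmetric := by
      refine (LinearMap.isSymmetric_iff_inner_map_self_real _).mpr fun z => ?_
      have h := Complex.conj_eq_iff_im.mpr (Complex.nonneg_iff.mp (hpos z)).2.symm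
      rw [inner_conj_symm] at h
      rw [inner_conj_symm]
      exact h.symm
    -- a phase that makes `⟨x, P y⟩` real and nonnegative
    obtain ⟨c, hc, hca⟩ : ∃ c : ℂ, ‖c‖ = 1 ∧ c * ⟪x, P y⟫_ℂ = ‖⟪x, P y⟫_ℂ‖ := by
      rcases eq_or_ne ⟪x, P y⟫_ℂ 0 with h | h
      · exact ⟨1, by simp, by simp [h]⟩
      · have h' : (‖⟪x, P y⟫_ℂ‖ : ℂ) ≠ 0 := by simpa using h
        refine ⟨star ⟪x, P y⟫_ℂ / ‖⟪x, P y⟫_ℂ‖, by simp [norm_inner_symm (P y) x, h], ?_⟩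
        rw [div_mul_eq_mul_div, div_eq_iff h', Complex.star_def, Complex.conj_mul', sq]
    have h1 := (Complex.nonneg_iff.mp (hpos (x - c • y))).1
    have h2 : ⟪y, P x⟫_ℂ = star ⟪x, P y⟫_ℂ := by
      rw [Complex.star_def, inner_conj_symm]
      exact (hsymm y x).symm
    have h3 : star c * c = 1 := by rw [Complex.star_def, Complex.conj_mul', hc]; simp
    have h4 : ⟪x - c • y, P (x - c • y)⟫_ℂ =
        ⟪x, P x⟫_ℂ + ⟪y, P y⟫_ℂ - (‖⟪x, P y⟫_ℂ‖ + star (‖⟪x, P y⟫_ℂ‖ : ℂ)) := by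
      rw [← hca, star_mul', ← h2]
      simp only [map_sub, map_smul, inner_sub_left, inner_sub_right, inner_smul_left,
        inner_smul_right]
      simp only [Complex.star_def] at h3 ⊢
      linear_combination ⟪y, P y⟫_ℂ * h3
    rw [h4] at h1
    simp only [Complex.star_def, Complex.conj_ofReal, Complex.sub_re, Complex.add_re,
      Complex.ofReal_re] at h1
    linarith
  have h1 := hasSum_trace hP
  have h2 : HasSum (fun n => ⟪ket n, (P * U) (ket n)⟫_ℂ) (trace (P * U)) :=
    hasSum_trace (by simpa using mul_mem_traceClass hP 1 U)
  have h3 : HasSum (fun n => ⟪ket n, (star U * P * U) (ket n)⟫_ℂ) (trace (star U * P * U)) :=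
    hasSum_trace (mul_mem_traceClass hP _ _)
  rw [trace_mul_mul hP, (Unitary.mem_iff.mp hU).2, mul_one] at h3
  have h4 := ((Complex.hasSum_re h1).add (Complex.hasSum_re h3)).mul_left 2⁻¹
  rw [← h2.tsum_eq]
  refine (tsum_of_norm_bounded h4 fun n => ?_).trans_eq (by ring)
  have := hbound (ket n) (U (ket n))
  simpa [ContinuousLinearMap.star_eq_adjoint, ContinuousLinearMap.adjoint_inner_right] using this

end Nuclear

/-! ### Coherent vectors, displacement operators and second quantization -/

theorem conj_conj {ι : Type} (U W : Op ι) (T : traceClass ι) : conj U (conj W T) = conj (U * W) T := by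
  refine Subtype.ext ?_
  change U * (W * T.1 * star W) * star U = U * W * T.1 * star (U * W)
  simp only [star_mul, mul_assoc]

theorem conj_one {ι : Type} (T : traceClass ι) : conj 1 T = T := by
  refine Subtype.ext ?_
  change 1 * T.1 * star 1 = T.1
  simp

section Coherent

variable {ι κ : Type} [Fintype ι] [Fintype κ]

open Matrix

theorem inner_expVec_dotProduct (z w : ι → ℂ) :
    ⟪expVec z, expVec w⟫_ℂ = Complex.exp (star z ⬝ᵥ w) :=
  inner_expVec z w

theorem sum_norm_sq_eq (ξ : ι → ℂ) : ((∑ j, ‖ξ j‖ ^ 2 : ℝ) : ℂ) = star ξ ⬝ᵥ ξ := by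
  rw [dotProduct]
  push_cast
  refine Finset.sum_congr rfl fun j _ => ?_
  simpa using (Complex.conj_mul' (ξ j)).symm

theorem displacement_expVec_dotProduct (ξ z : ι → ℂ) :
    displacement ξ (expVec z) =
      Complex.exp (-(star ξ ⬝ᵥ ξ) / 2 - star ξ ⬝ᵥ z) • expVec (z + ξ) := by
  rw [displacement_expVec, sum_norm_sq_eq]
  rfl

theorem conj_dotProduct (z w : ι → ℂ) : (starRingEnd ℂ) (star z ⬝ᵥ w) = star w ⬝ᵥ z := by
  rw [← Complex.star_def, star_dotProduct, star_star]

/-- The coherent vectors are total, so bounded operators are determined by their values on them. -/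
theorem clm_ext {F : Type*} [NormedAddCommGroup F] [NormedSpace ℂ F] {A B : Fock ι →L[ℂ] F}
    (h : ∀ z, A (expVec z) = B (expVec z)) : A = B := by
  refine ContinuousLinearMap.coeFn_injective
    (denseRange_expVec.equalizer A.continuous B.continuous (funext fun c => ?_))
  simp [Finsupp.linearCombination_apply, Finsupp.sum, h]

theorem eq_of_inner_expVec {f g : Fock ι} (h : ∀ z, ⟪expVec z, f⟫_ℂ = ⟪expVec z, g⟫_ℂ) :
    f = g := by
  refine sub_eq_zero.mp (eq_zero_of_inner_expVec fun z => ?_)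
  rw [← inner_conj_symm, inner_sub_right, h, sub_self, map_zero]

theorem op_ext_inner {A B : Fock ι →L[ℂ] Fock κ}
    (h : ∀ w z, ⟪expVec w, A (expVec z)⟫_ℂ = ⟪expVec w, B (expVec z)⟫_ℂ) : A = B :=
  clm_ext fun z => eq_of_inner_expVec fun w => h w z

theorem inner_displacement (w ξ z : ι → ℂ) :
    ⟪expVec w, displacement ξ (expVec z)⟫_ℂ =
      Complex.exp (-(star ξ ⬝ᵥ ξ) / 2 - star ξ ⬝ᵥ z + star w ⬝ᵥ ξ + star w ⬝ᵥ z) := by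
  rw [displacement_expVec_dotProduct, inner_smul_right, inner_expVec_dotProduct,
    ← Complex.exp_add, dotProduct_add]
  congr 1
  ring

/-- The Weyl relation. -/
theorem displacement_mul (ξ η : ι → ℂ) :
    displacement ξ * displacement η =
      Complex.exp ((star η ⬝ᵥ ξ - star ξ ⬝ᵥ η) / 2) • displacement (ξ + η) := by
  refine clm_ext fun z => ?_
  simp only [mul_apply_eq_comp, _root_.smul_apply,
    displacement_expVec_dotProduct, map_smul, smul_smul, ← Complex.exp_add, add_assoc,
    add_comm η ξ]
  congr 2
  simp only [star_add, add_dotProduct, dotProduct_add]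
  ring

theorem displacement_zero : displacement (0 : ι → ℂ) = 1 :=
  clm_ext fun z => by simp [displacement_expVec_dotProduct]

theorem star_displacement (ξ : ι → ℂ) : star (displacement ξ) = displacement (-ξ) := by
  refine op_ext_inner fun w z => ?_
  rw [ContinuousLinearMap.star_eq_adjoint, ContinuousLinearMap.adjoint_inner_right,
    inner_displacement, ← inner_conj_symm, inner_displacement, ← Complex.exp_conj]
  congr 1
  simp only [map_add, map_sub, map_neg, map_div₀, conj_dotProduct, Complex.conj_ofNat, star_neg,
    neg_dotProduct, dotProduct_neg]
  ring

theorem displacement_mul_neg (ξ : ι → ℂ) : displacement ξ * displacement (-ξ) = 1 := by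
  rw [displacement_mul, add_neg_cancel, displacement_zero]
  simp

theorem displacement_mem_unitary (ξ : ι → ℂ) : displacement ξ ∈ unitary (Op ι) := by
  rw [Unitary.mem_iff, star_displacement]
  exact ⟨by simpa using displacement_mul_neg (-ξ), displacement_mul_neg ξ⟩

/-- A map defined on coherent vectors that preserves their inner products extends to a bounded
operator. -/
theorem exists_clm_of_inner_eq {F : Type*} [NormedAddCommGroup F] [InnerProductSpace ℂ F]
    [CompleteSpace F] (f : (ι → ℂ) → F) (hf : ∀ z w, ⟪f z, f w⟫_ℂ = ⟪expVec z, expVec w⟫_ℂ) :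
    ∃ A : Fock ι →L[ℂ] F, ∀ z, A (expVec z) = f z := by
  have hnorm : ∀ c : (ι → ℂ) →₀ ℂ, ‖Finsupp.linearCombination ℂ f c‖ =
      ‖Finsupp.linearCombination ℂ (expVec (ι := ι)) c‖ := by
    intro c
    rw [@norm_eq_sqrt_re_inner ℂ, @norm_eq_sqrt_re_inner ℂ]
    simp only [Finsupp.linearCombination_apply, Finsupp.sum, sum_inner, inner_sum,
      inner_smul_left, inner_smul_right, hf]
  refine ⟨(Finsupp.linearCombination ℂ f).extendOfNorm
    (Finsupp.linearCombination ℂ (expVec (ι := ι))), fun z => ?_⟩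
  simpa [Finsupp.linearCombination_single] using LinearMap.extendOfNorm_eq
    (f := Finsupp.linearCombination ℂ f) denseRange_expVec ⟨1, fun c => by rw [hnorm c, one_mul]⟩ (Finsupp.single z 1)

/-- Operators that are multiplicative and diagonal in the number basis rescale the amplitudes of
coherent vectors. -/
theorem diagonal_expVec (c : ι → ℂ) (hc : ∀ j, ‖c j‖ ≤ 1) (z : ι → ℂ) :
    GaussianThermo.diagonal (fun n => ∏ j, c j ^ n j) (expVec z) = expVec (c * z) := by
  ext n
  rw [diagonal_apply ⟨1, fun n => ?_⟩]
  · change _ * ∏ j, _ = ∏ j, _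
    rw [← Finset.prod_mul_distrib]
    refine Finset.prod_congr rfl fun j _ => ?_
    rw [Pi.mul_apply, mul_pow, mul_div_assoc]
  · rw [norm_prod]
    exact Finset.prod_le_one (fun _ _ => norm_nonneg _) fun j _ => by
      rw [norm_pow]; exact pow_le_one₀ (norm_nonneg _) (hc j)

variable [DecidableEq ι]

theorem dotProduct_unitary (V : unitaryGroup ι ℂ) (z w : ι → ℂ) :
    star ((V : Matrix ι ι ℂ) *ᵥ z) ⬝ᵥ ((V : Matrix ι ι ℂ) *ᵥ w) = star z ⬝ᵥ w := by
  rw [star_mulVec, dotProduct_mulVec, vecMul_vecMul, ← star_eq_conjTranspose,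
    UnitaryGroup.star_mul_self, vecMul_one]

theorem exists_secondQuant (V : unitaryGroup ι ℂ) :
    ∃ U : Op ι, ∀ z, U (expVec z) = expVec ((V : Matrix ι ι ℂ) *ᵥ z) :=
  exists_clm_of_inner_eq _ fun z w => by
    rw [inner_expVec_dotProduct, inner_expVec_dotProduct, dotProduct_unitary]

/-- The second quantization of a unitary matrix `V`: the operator on Fock space with
`e(z) ↦ e(V z)` on coherent vectors. -/
def secondQuant (V : unitaryGroup ι ℂ) : Op ι := (exists_secondQuant V).choose

theorem secondQuant_expVec (V : unitaryGroup ι ℂ) (z : ι → ℂ) :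
    secondQuant V (expVec z) = expVec ((V : Matrix ι ι ℂ) *ᵥ z) :=
  (exists_secondQuant V).choose_spec z

theorem secondQuant_mul (V W : unitaryGroup ι ℂ) :
    secondQuant V * secondQuant W = secondQuant (V * W) :=
  clm_ext fun z => by simp [secondQuant_expVec]

theorem secondQuant_one : secondQuant (1 : unitaryGroup ι ℂ) = 1 :=
  clm_ext fun z => by simp [secondQuant_expVec]

theorem star_secondQuant (V : unitaryGroup ι ℂ) : star (secondQuant V) = secondQuant (star V) := by
  refine op_ext_inner fun w z => ?_
  rw [ContinuousLinearMap.star_eq_adjoint, ContinuousLinearMap.adjoint_inner_right,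
    secondQuant_expVec, secondQuant_expVec, inner_expVec_dotProduct, inner_expVec_dotProduct,
    ← dotProduct_unitary V w, mulVec_mulVec]
  simp

theorem secondQuant_mem_unitary (V : unitaryGroup ι ℂ) : secondQuant V ∈ unitary (Op ι) := by
  rw [Unitary.mem_iff, star_secondQuant, secondQuant_mul, secondQuant_mul]
  simp [secondQuant_one]

theorem secondQuant_mul_displacement (V : unitaryGroup ι ℂ) (ξ : ι → ℂ) :
    secondQuant V * displacement ξ * star (secondQuant V) =
      displacement ((V : Matrix ι ι ℂ) *ᵥ ξ) := by
  have h : secondQuant V * displacement ξ =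
      displacement ((V : Matrix ι ι ℂ) *ᵥ ξ) * secondQuant V := by
    refine clm_ext fun z => ?_
    simp only [mul_apply_eq_comp, displacement_expVec_dotProduct, map_smul,
      secondQuant_expVec, dotProduct_unitary, mulVec_add]
  rw [h, mul_assoc, (Unitary.mem_iff.mp (secondQuant_mem_unitary V)).2, mul_one]

theorem implements_secondQuant (V : unitaryGroup ι ℂ) : Implements (secondQuant V) V :=
  ⟨secondQuant_mem_unitary V, secondQuant_mul_displacement V⟩

theorem isGaussianUnitary_secondQuant (V : unitaryGroup ι ℂ) :
    IsGaussianUnitary (secondQuant V) := by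
  refine ⟨secondQuant_mem_unitary V, (V : Matrix ι ι ℂ).mulVecLin.restrictScalars ℝ, 0,
    fun ξ η => congrArg Complex.im (dotProduct_unitary V ξ η), fun ξ => ?_⟩
  simpa using secondQuant_mul_displacement V ξ

/-- Conjugation with the second quantization of `V` substitutes `V† ξ` in characteristic functions. -/
theorem charFun_conj_secondQuant (V : unitaryGroup ι ℂ) (T : traceClass ι) (ξ : ι → ℂ) :
    charFun (conj (secondQuant V) T : Op ι) ξ =
      charFun (T : Op ι) ((star V : Matrix ι ι ℂ) *ᵥ ξ) := by
  have h := secondQuant_mul_displacement (star V) ξ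
  rw [← star_secondQuant, star_star] at h
  change trace (secondQuant V * T.1 * star (secondQuant V) * displacement ξ) = _
  rw [mul_assoc, trace_mul_mul T.2, h]
  rfl

/-- The unitary matrix of single-mode phases `exp (-i ωⱼ t)`. -/
def phase (ω : ι → ℝ) (t : ℝ) : unitaryGroup ι ℂ :=
  ⟨Matrix.diagonal fun j => Complex.exp (-(Complex.I * t * ω j)), by
    rw [mem_unitaryGroup_iff, star_eq_conjTranspose, diagonal_conjTranspose, diagonal_mul_diagonal,
      ← diagonal_one]
    congr 1
    funext j
    rw [Pi.star_apply, Complex.star_def, ← Complex.exp_conj, ← Complex.exp_add]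
    simp⟩

theorem phase_mulVec (ω : ι → ℝ) (t : ℝ) (ξ : ι → ℂ) (j : ι) :
    ((phase ω t : Matrix ι ι ℂ) *ᵥ ξ) j = Complex.exp (-(Complex.I * t * ω j)) * ξ j :=
  mulVec_diagonal _ _ _

theorem star_phase (ω : ι → ℝ) (t : ℝ) : star (phase ω t) = phase ω (-t) := by
  refine Subtype.ext ?_
  change star (Matrix.diagonal _) = Matrix.diagonal _
  rw [star_eq_conjTranspose, diagonal_conjTranspose]
  congr 1
  funext j
  rw [Pi.star_apply, Complex.star_def, ← Complex.exp_conj]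
  simp

theorem evolution_eq_secondQuant (ω : ι → ℝ) (t : ℝ) :
    evolution ω t = secondQuant (phase ω t) := by
  have h : evolution ω t = GaussianThermo.diagonal
      (fun n => ∏ j, Complex.exp (-(Complex.I * t * ω j)) ^ n j) := by
    rw [evolution]
    congr 1
    funext n
    simp only [← Complex.exp_nat_mul, ← Complex.exp_sum, energy]
    congr 1
    push_cast
    rw [Finset.mul_sum, ← Finset.sum_neg_distrib]
    exact Finset.sum_congr rfl fun j _ => by ring
  refine clm_ext fun z => ?_
  rw [h, diagonal_expVec _ (fun j => by rw [Complex.norm_exp]; simp), secondQuant_expVec]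
  congr 1
  funext j
  rw [phase_mulVec, Pi.mul_apply]

theorem charFun_conj_evolution (ω : ι → ℝ) (t : ℝ) (T : traceClass ι) (ξ : ι → ℂ) :
    charFun (conj (evolution ω t) T : Op ι) ξ =
      charFun (T : Op ι) ((phase ω (-t) : Matrix ι ι ℂ) *ᵥ ξ) := by
  rw [evolution_eq_secondQuant, charFun_conj_secondQuant, ← star_phase]
  rfl

end Coherent

/-! ### Matrices that respect the resonances -/

section Resonant

variable {ι κ : Type} [Fintype ι] [Fintype κ]

open Matrix

/-- A matrix that only couples modes of equal frequency. -/
def Resonant {ι : Type} (ω : ι → ℝ) (V : Matrix ι ι ℂ) : Prop := ∀ i j, V i j ≠ 0 → ω i = ω j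

theorem Resonant.mul {ω : ι → ℝ} {V W : Matrix ι ι ℂ} (hV : Resonant ω V) (hW : Resonant ω W) :
    Resonant ω (V * W) := by
  intro i j h
  obtain ⟨k, -, hk⟩ := Finset.exists_ne_zero_of_sum_ne_zero h
  exact (hV i k (left_ne_zero_of_mul hk)).trans (hW k j (right_ne_zero_of_mul hk))

theorem Resonant.star {ι : Type} {ω : ι → ℝ} {V : Matrix ι ι ℂ} (hV : Resonant ω V) :
    Resonant ω (star V) := by
  intro i j h
  refine (hV j i fun h0 => h ?_).symm
  rw [star_apply, h0, star_zero]

theorem Resonant.mul_diagonal [DecidableEq ι] {ω : ι → ℝ} {V : Matrix ι ι ℂ} (hV : Resonant ω V)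
    (g : ℝ → ℂ) : V * Matrix.diagonal (fun j => g (ω j)) =
      Matrix.diagonal (fun j => g (ω j)) * V := by
  ext i j
  rw [Matrix.mul_diagonal, Matrix.diagonal_mul]
  by_cases h : V i j = 0
  · simp [h]
  · rw [hV i j h, mul_comm]

theorem isPassive_secondQuant [DecidableEq ι] {ω : ι → ℝ} {V : unitaryGroup ι ℂ}
    (hV : Resonant ω (V : Matrix ι ι ℂ)) : IsPassive ω (secondQuant V) := by
  refine ⟨isGaussianUnitary_secondQuant V, fun t => ?_⟩
  rw [evolution_eq_secondQuant, secondQuant_mul, secondQuant_mul]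
  congr 1
  exact Subtype.ext (hV.mul_diagonal fun x => Complex.exp (-(Complex.I * t * x)))

end Resonant

/-! ### Tensor products and partial traces -/

section Tensor

variable {ι κ : Type}

theorem hasSum_inner_coord (ψ φ : Fock ι) : HasSum (fun n => φ n * star (ψ n)) ⟪ψ, φ⟫_ℂ :=
  lp.hasSum_inner (𝕜 := ℂ) ψ φ

theorem tmul_apply (ψ : Fock ι) (φ : Fock κ) (n : ι ⊕ κ → ℕ) :
    tmul ψ φ n = ψ (n ∘ Sum.inl) * φ (n ∘ Sum.inr) := rfl

theorem hasSum_mul_sum {f : (ι → ℕ) → ℂ} {g : (κ → ℕ) → ℂ} {a b : ℂ} (h1 : HasSum f a)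
    (h2 : HasSum g b) :
    HasSum (fun n : ι ⊕ κ → ℕ => f (n ∘ Sum.inl) * g (n ∘ Sum.inr)) (a * b) := by
  have h3 := h1.mul h2 (summable_mul_of_summable_norm h1.summable.norm h2.summable.norm)
  exact (Equiv.sumArrowEquivProdArrow ι κ ℕ).hasSum_iff.mpr h3

theorem inner_tmul (ψ ψ' : Fock ι) (φ φ' : Fock κ) :
    ⟪tmul ψ φ, tmul ψ' φ'⟫_ℂ = ⟪ψ, ψ'⟫_ℂ * ⟪φ, φ'⟫_ℂ := by
  refine (hasSum_inner_coord _ _).unique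
    ((hasSum_mul_sum (hasSum_inner_coord ψ ψ') (hasSum_inner_coord φ φ')).congr_fun fun n => ?_)
  simp only [tmul_apply, star_mul']
  ring

theorem norm_tmul (ψ : Fock ι) (φ : Fock κ) : ‖tmul ψ φ‖ = ‖ψ‖ * ‖φ‖ := by
  have h := inner_tmul ψ ψ φ φ
  rw [inner_self_eq_norm_sq_to_K, inner_self_eq_norm_sq_to_K, inner_self_eq_norm_sq_to_K,
    ← mul_pow] at h
  have h' : ‖tmul ψ φ‖ ^ 2 = (‖ψ‖ * ‖φ‖) ^ 2 := by exact_mod_cast h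
  exact (sq_eq_sq₀ (norm_nonneg _) (by positivity)).mp h'

/-- The embedding `ψ ↦ ψ ⊗ φ`. -/
def tmulLeft (φ : Fock κ) : Fock ι →L[ℂ] Fock (ι ⊕ κ) :=
  LinearMap.mkContinuous
    { toFun := fun ψ => tmul ψ φ
      map_add' := fun ψ ψ' => by ext n; exact add_mul _ _ _
      map_smul' := fun c ψ => by ext n; exact mul_assoc _ _ _ } ‖φ‖
    fun ψ => by rw [mul_comm]; exact (norm_tmul ψ φ).le

/-- The embedding `φ ↦ ψ ⊗ φ`. -/
def tmulRight (ψ : Fock ι) : Fock κ →L[ℂ] Fock (ι ⊕ κ) :=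
  LinearMap.mkContinuous
    { toFun := fun φ => tmul ψ φ
      map_add' := fun φ φ' => by ext n; exact mul_add _ _ _
      map_smul' := fun c φ => by ext n; exact mul_left_comm _ _ _ } ‖ψ‖
    fun φ => (norm_tmul ψ φ).le

theorem tmulLeft_apply (ψ : Fock ι) (φ : Fock κ) : tmulLeft φ ψ = tmul ψ φ := rfl

theorem tmulRight_apply (ψ : Fock ι) (φ : Fock κ) : tmulRight ψ φ = tmul ψ φ := rfl

theorem tmul_ket (n : ι → ℕ) (l : κ → ℕ) : tmul (ket n) (ket l) = ket (Sum.elim n l) := by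
  classical
  ext k
  change ket n (k ∘ Sum.inl) * ket l (k ∘ Sum.inr) = _
  have h : k = Sum.elim n l ↔ k ∘ Sum.inl = n ∧ k ∘ Sum.inr = l := by
    constructor
    · rintro rfl; exact ⟨rfl, rfl⟩
    · rintro ⟨rfl, rfl⟩; exact (Sum.elim_comp_inl_inr k).symm
  simp only [ket, lp.coeFn_single, Pi.single_apply, h]
  split_ifs <;> simp_all

/-- The component `⟨l|Ψ` of a vector of the composite system along the number state `|l⟩` of the
second factor. -/
def slice (l : κ → ℕ) : Fock (ι ⊕ κ) →L[ℂ] Fock ι :=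
  ContinuousLinearMap.adjoint (tmulLeft (ket l))

theorem inner_slice (ψ : Fock ι) (l : κ → ℕ) (Ψ : Fock (ι ⊕ κ)) :
    ⟪ψ, slice l Ψ⟫_ℂ = ⟪tmul ψ (ket l), Ψ⟫_ℂ :=
  ContinuousLinearMap.adjoint_inner_right _ _ _

theorem inner_slice_left (ψ : Fock ι) (l : κ → ℕ) (Ψ : Fock (ι ⊕ κ)) :
    ⟪slice l Ψ, ψ⟫_ℂ = ⟪Ψ, tmul ψ (ket l)⟫_ℂ :=
  ContinuousLinearMap.adjoint_inner_left _ _ _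

theorem slice_apply (l : κ → ℕ) (Ψ : Fock (ι ⊕ κ)) (n : ι → ℕ) :
    slice l Ψ n = Ψ (Sum.elim n l) := by
  rw [← inner_ket, inner_slice, tmul_ket, inner_ket]

theorem hasSum_inner_slice (Ψ Φ : Fock (ι ⊕ κ)) :
    HasSum (fun l : κ → ℕ => ⟪slice l Ψ, slice l Φ⟫_ℂ) ⟪Ψ, Φ⟫_ℂ := by
  have h := (((Equiv.sumArrowEquivProdArrow ι κ ℕ).trans (Equiv.prodComm _ _)).symm.hasSum_iff).mpr
    (lp.hasSum_inner (𝕜 := ℂ) Ψ Φ)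
  refine h.prod_fiberwise fun l => ?_
  refine (lp.hasSum_inner (𝕜 := ℂ) (slice l Ψ) (slice l Φ)).congr_fun fun n => ?_
  rw [slice_apply, slice_apply]
  rfl

theorem hasSum_norm_slice_sq (Ψ : Fock (ι ⊕ κ)) :
    HasSum (fun l : κ → ℕ => ‖slice l Ψ‖ ^ 2) (‖Ψ‖ ^ 2) := by
  have h := Complex.hasSum_re (hasSum_inner_slice Ψ Ψ)
  have h2 : ∀ {ι : Type} (f : Fock ι), (⟪f, f⟫_ℂ).re = ‖f‖ ^ 2 := fun f =>
    inner_self_eq_norm_sq (𝕜 := ℂ) f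
  simpa only [h2] using h

variable {I J : Type}

theorem IsNuclear.tensor {u v : I → Fock ι} {T : Op ι} (h : IsNuclear u v T)
    {a b : J → Fock κ} {S : Op κ} (h' : IsNuclear a b S) :
    ∃ P : Op (ι ⊕ κ), IsTensor P T S ∧
      IsNuclear (fun p : I × J => tmul (u p.1) (a p.2)) (fun p => tmul (v p.1) (b p.2)) P := by
  obtain ⟨P, hP⟩ := exists_of_summable (fun p : I × J => tmul (u p.1) (a p.2))
    (fun p => tmul (v p.1) (b p.2)) (by
      refine (h.1.mul_of_nonneg h'.1 (fun _ => by positivity) (fun _ => by positivity)).congr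
        fun p => ?_
      rw [norm_tmul, norm_tmul]
      ring)
  refine ⟨P, fun ψ φ => ?_, hP⟩
  have h1 := hP.2 (tmul ψ φ)
  have h2 : ∀ i, HasSum (fun j => ⟪tmul (v i) (b j), tmul ψ φ⟫_ℂ • tmul (u i) (a j))
      (⟪v i, ψ⟫_ℂ • tmul (u i) (S φ)) := by
    intro i
    refine (((h'.2 φ).mapL (tmulRight (u i))).const_smul ⟪v i, ψ⟫_ℂ).congr_fun fun j => ?_
    rw [map_smul, tmulRight_apply, smul_smul, inner_tmul]
  refine (h1.prod_fiberwise h2).unique (((h.2 ψ).mapL (tmulLeft (S φ))).congr_fun fun i => ?_)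
  rw [map_smul, tmulLeft_apply]

theorem IsPartialTrace.unique {P : Op (ι ⊕ κ)} {Q Q' : Op ι} (h : IsPartialTrace P Q)
    (h' : IsPartialTrace P Q') : Q = Q' :=
  ContinuousLinearMap.ext fun φ => ext_inner_left ℂ fun ψ => (h ψ φ).unique (h' ψ φ)

/-- The partial trace of `∑ᵢ |uᵢ⟩⟨vᵢ|` is `∑ᵢ ∑ₗ |⟨l|uᵢ⟩⟨⟨l|vᵢ⟩|`, again a nuclear sum. -/
theorem IsNuclear.partialTrace {u v : I → Fock (ι ⊕ κ)} {X : Op (ι ⊕ κ)} (h : IsNuclear u v X) :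
    ∃ Q : Op ι, IsPartialTrace X Q ∧
      IsNuclear (fun p : I × (κ → ℕ) => slice p.2 (u p.1)) (fun p => slice p.2 (v p.1)) Q := by
  have hcs : ∀ i, (Summable fun l : κ → ℕ => ‖slice l (u i)‖ * ‖slice l (v i)‖) ∧
      ∑' l : κ → ℕ, ‖slice l (u i)‖ * ‖slice l (v i)‖ ≤ ‖u i‖ * ‖v i‖ := fun i =>
    summable_mul_of_hasSum_sq (fun _ => norm_nonneg _) (fun _ => norm_nonneg _)
      (norm_nonneg _) (norm_nonneg _) (hasSum_norm_slice_sq _) (hasSum_norm_slice_sq _)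
  obtain ⟨Q, hQ⟩ := exists_of_summable (fun p : I × (κ → ℕ) => slice p.2 (u p.1))
    (fun p => slice p.2 (v p.1)) (by
      refine (summable_prod_of_nonneg fun _ => by positivity).mpr ⟨fun i => (hcs i).1, ?_⟩
      exact Summable.of_nonneg_of_le (fun i => tsum_nonneg fun _ => by positivity)
        (fun i => (hcs i).2) h.1)
  refine ⟨Q, fun ψ φ => ?_, hQ⟩
  have h1 := hQ.hasSum_inner φ ψ
  refine ((Equiv.prodComm (κ → ℕ) I).hasSum_iff.mpr h1).prod_fiberwise fun k => ?_
  refine (h.hasSum_inner (tmul φ (ket k)) (tmul ψ (ket k))).congr_fun fun i => ?_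
  rw [Function.comp_apply, inner_slice, inner_slice_left]
  rfl

end Tensor

section TensorModes

variable {ι κ : Type} [Fintype ι] [Fintype κ]

theorem tmul_expVec (z : ι → ℂ) (w : κ → ℂ) :
    tmul (expVec z) (expVec w) = expVec (Sum.elim z w) := by
  ext n
  change (∏ j, _) * (∏ j, _) = ∏ j, _
  rw [Fintype.prod_sum_type]
  rfl

/-- It suffices to check a tensor product on products of coherent vectors. -/
theorem isTensor_of_expVec {P : Op (ι ⊕ κ)} {A : Op ι} {B : Op κ}
    (h : ∀ z w, P (expVec (Sum.elim z w)) = tmul (A (expVec z)) (B (expVec w))) :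
    IsTensor P A B := by
  have h1 : ∀ z φ, P (tmul (expVec z) φ) = tmul (A (expVec z)) (B φ) := fun z =>
    DFunLike.congr_fun (F := Fock κ →L[ℂ] Fock (ι ⊕ κ))
      (f := P ∘L tmulRight (expVec z)) (g := tmulRight (A (expVec z)) ∘L B)
      (clm_ext fun w => by
        change P (tmul (expVec z) (expVec w)) = _
        rw [tmul_expVec, h]
        rfl)
  intro ψ φ
  exact DFunLike.congr_fun (F := Fock ι →L[ℂ] Fock (ι ⊕ κ))
    (f := P ∘L tmulLeft φ) (g := tmulLeft (B φ) ∘L A) (clm_ext fun z => h1 z φ) ψ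

theorem IsTensor.unique {P P' : Op (ι ⊕ κ)} {A : Op ι} {B : Op κ} (h : IsTensor P A B)
    (h' : IsTensor P' A B) : P = P' :=
  clm_ext fun z => by
    rw [← Sum.elim_comp_inl_inr z, ← tmul_expVec, h, h']

theorem isTensor_displacement (ξ : ι → ℂ) (η : κ → ℂ) :
    IsTensor (displacement (Sum.elim ξ η)) (displacement ξ) (displacement η) := by
  refine isTensor_of_expVec fun z w => ?_
  rw [displacement_expVec_dotProduct, displacement_expVec_dotProduct,
    displacement_expVec_dotProduct, ← tmulLeft_apply, map_smul, tmulLeft_apply, ← tmulRight_apply,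
    map_smul, tmulRight_apply, tmul_expVec, smul_smul, ← Complex.exp_add]
  have h1 : star (Sum.elim ξ η) = Sum.elim (star ξ) (star η) := by
    ext j; cases j <;> rfl
  have h2 : Sum.elim z w + Sum.elim ξ η = Sum.elim (z + ξ) (w + η) := by
    ext j; cases j <;> rfl
  rw [h1, h2, sumElim_dotProduct_sumElim, sumElim_dotProduct_sumElim]
  congr 2
  ring

/-- The characteristic function of a product operator factorizes. -/
theorem IsTensor.charFun_eq {P : Op (ι ⊕ κ)} {T : Op ι} {S : Op κ} (h : IsTensor P T S)
    (hT : T ∈ traceClass ι) (hS : S ∈ traceClass κ) (ξ : ι → ℂ) (η : κ → ℂ) :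
    charFun P (Sum.elim ξ η) = charFun T ξ * charFun S η := by
  obtain ⟨I, u, v, hu⟩ := exists_isNuclear hT
  obtain ⟨J, a, b, ha⟩ := exists_isNuclear hS
  obtain ⟨P', hP', hn⟩ := hu.tensor ha
  obtain rfl := h.unique hP'
  have h1 := hn.hasSum_trace_mul_right (displacement (Sum.elim ξ η))
  have h2 : ∀ i, HasSum (fun j => ⟪tmul (v i) (b j),
      displacement (Sum.elim ξ η) (tmul (u i) (a j))⟫_ℂ)
      (⟪v i, displacement ξ (u i)⟫_ℂ * charFun S η) := by
    intro i
    refine ((ha.hasSum_trace_mul_right (displacement η)).mul_left _).congr_fun fun j => ?_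
    rw [isTensor_displacement, inner_tmul]
  exact (h1.prod_fiberwise h2).unique ((hu.hasSum_trace_mul_right (displacement ξ)).mul_right _)

theorem IsTensor.mem_traceClass {P : Op (ι ⊕ κ)} {T : Op ι} {S : Op κ} (h : IsTensor P T S)
    (hT : T ∈ traceClass ι) (hS : S ∈ traceClass κ) : P ∈ traceClass (ι ⊕ κ) := by
  obtain ⟨I, u, v, hu⟩ := exists_isNuclear hT
  obtain ⟨J, a, b, ha⟩ := exists_isNuclear hS
  obtain ⟨P', hP', hn⟩ := hu.tensor ha
  obtain rfl := h.unique hP'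
  exact hn.mem

theorem slice_displacement (ξ : ι → ℂ) (l : κ → ℕ) (Ψ : Fock (ι ⊕ κ)) :
    slice l (displacement (Sum.elim ξ (0 : κ → ℂ)) Ψ) = displacement ξ (slice l Ψ) := by
  have hs : ∀ {ι : Type} [Fintype ι] (ξ : ι → ℂ) (x y : Fock ι),
      ⟪x, displacement ξ y⟫_ℂ = ⟪displacement (-ξ) x, y⟫_ℂ := by
    intro ι _ ξ x y
    rw [← star_displacement, ContinuousLinearMap.star_eq_adjoint,
      ContinuousLinearMap.adjoint_inner_left]
  refine ext_inner_left ℂ fun ψ => ?_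
  have h1 : -Sum.elim ξ (0 : κ → ℂ) = Sum.elim (-ξ) 0 := by
    ext j; cases j <;> simp
  rw [inner_slice, hs, h1, isTensor_displacement, displacement_zero, hs ξ, inner_slice]
  rfl

/-- Reducing to a subsystem restricts the characteristic function. -/
theorem exists_partialTrace {X : Op (ι ⊕ κ)} (hX : X ∈ traceClass (ι ⊕ κ)) :
    ∃ Q : traceClass ι, IsPartialTrace X (Q : Op ι) ∧
      ∀ ξ, charFun (Q : Op ι) ξ = charFun X (Sum.elim ξ 0) := by
  obtain ⟨I, u, v, h⟩ := exists_isNuclear hX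
  obtain ⟨Q, hQ, hn⟩ := h.partialTrace
  refine ⟨⟨Q, hn.mem⟩, hQ, fun ξ => ?_⟩
  have h1 := hn.hasSum_trace_mul_right (displacement ξ)
  refine (h1.prod_fiberwise fun i => ?_).unique
    (h.hasSum_trace_mul_right (displacement (Sum.elim ξ 0)))
  refine (hasSum_inner_slice (v i) (displacement (Sum.elim ξ 0) (u i))).congr_fun fun l => ?_
  rw [slice_displacement]

end TensorModes

/-! ### Gibbs states -/

section NumberStates

variable {ι : Type}

theorem norm_ket (n : ι → ℕ) : ‖ket n‖ = 1 := by
  classical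
  rw [ket, lp.norm_single (by norm_num), norm_one]

theorem ket_apply_self (n : ι → ℕ) : ket n n = 1 := by
  rw [← inner_ket, inner_self_eq_norm_sq_to_K, norm_ket]
  simp

theorem ket_apply_of_ne {n l : ι → ℕ} (h : n ≠ l) : ket l n = 0 := by
  classical
  rw [ket, lp.coeFn_single, Pi.single_eq_of_ne h]

theorem hasSum_ket (f : Fock ι) : HasSum (fun n => f n • ket n) f := by
  classical
  refine (lp.hasSum_single (p := 2) (by norm_num) f).congr_fun fun n => ?_
  rw [ket, ← lp.single_smul, smul_eq_mul, mul_one]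

end NumberStates

section Gibbs

variable {ι : Type} [Fintype ι]

open Matrix

theorem inner_expVec_ket (w : ι → ℂ) (n : ι → ℕ) :
    ⟪expVec w, ket n⟫_ℂ = ∏ j, star (w j) ^ n j / (Real.sqrt (n j).factorial : ℂ) := by
  rw [← inner_conj_symm, inner_ket]
  change (starRingEnd ℂ) (∏ j, _) = _
  rw [map_prod]
  refine Finset.prod_congr rfl fun j _ => ?_
  rw [map_div₀, map_pow, Complex.conj_ofReal]
  rfl

/-- An operator of the form `e(z) ↦ k exp (-⟨ζ, z⟩) e(c z)` is triangular in the number basis, with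
the same diagonal as the second quantization of `c`. -/
theorem inner_ket_of_expVec {A : Op ι} {k : ℂ} {ζ : ι → ℂ} {c : ι → ℝ}
    (hA : ∀ z, A (expVec z) =
      (k * Complex.exp (-(star ζ ⬝ᵥ z))) • expVec (fun j => (c j : ℂ) * z j)) (n : ι → ℕ) :
    ⟪ket n, A (ket n)⟫_ℂ = k * ∏ j, (c j : ℂ) ^ n j := by
  classical
  have hadj : ∀ w, star A (expVec w) = star k • expVec (fun j => (c j : ℂ) * w j - ζ j) := by
    refine fun w => eq_of_inner_expVec fun z => ?_
    rw [ContinuousLinearMap.star_eq_adjoint, ContinuousLinearMap.adjoint_inner_right, hA,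
      inner_smul_left, inner_smul_right, inner_expVec_dotProduct, inner_expVec_dotProduct,
      map_mul, mul_assoc, ← Complex.exp_conj, ← Complex.exp_add, map_neg, conj_dotProduct]
    congr 2
    have h : (fun j => (c j : ℂ) * w j - ζ j) = (fun j => (c j : ℂ) * w j) - ζ := rfl
    rw [h, dotProduct_sub]
    have h2 : star (fun j => (c j : ℂ) * z j) ⬝ᵥ w = star z ⬝ᵥ fun j => (c j : ℂ) * w j := by
      refine Finset.sum_congr rfl fun j _ => ?_
      simp
      ring
    rw [h2]
    ring
  set a : ι → ℕ → ℂ := fun j l => (c j : ℂ) ^ l * (-star (ζ j)) ^ (n j - l) * (n j).choose l *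
    (Real.sqrt l.factorial / Real.sqrt (n j).factorial : ℂ) with ha
  set g : Fock ι := ∑ l ∈ Fintype.piFinset fun j => Finset.range (n j + 1),
    (∏ j, a j (l j)) • ket l with hg
  have hfac : ∀ l : ℕ, (Real.sqrt l.factorial : ℂ) ≠ 0 := fun l => by
    simpa using (Real.sqrt_pos.mpr (Nat.cast_pos.mpr l.factorial_pos)).ne'
  -- the coherent matrix elements of `A |n⟩` are polynomials, expanded here by the binomial theorem
  have hAg : A (ket n) = k • g := by
    refine eq_of_inner_expVec fun w => ?_
    rw [← ContinuousLinearMap.adjoint_inner_left, ← ContinuousLinearMap.star_eq_adjoint, hadj,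
      inner_smul_left, inner_smul_right, inner_expVec_ket, hg, inner_sum]
    simp only [inner_smul_right, inner_expVec_ket, ← Finset.prod_mul_distrib]
    rw [← Finset.prod_univ_sum (fun j => Finset.range (n j + 1))
      (fun j l => a j l * (star (w j) ^ l / (Real.sqrt l.factorial : ℂ)))]
    congr 1
    · simp
    · refine Finset.prod_congr rfl fun j _ => ?_
      have h : star ((c j : ℂ) * w j - ζ j) = (c j : ℂ) * star (w j) + -star (ζ j) := by
        simp [sub_eq_add_neg]
      rw [h, add_pow, Finset.sum_div]
      refine Finset.sum_congr rfl fun l _ => ?_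
      have := hfac l
      simp only [ha]
      field_simp
      ring
  have hgn : g n = ∏ j, a j (n j) := by
    rw [← inner_ket, hg, inner_sum, Finset.sum_eq_single n]
    · rw [inner_smul_right, inner_ket, ket_apply_self, mul_one]
    · intro l _ hl
      rw [inner_smul_right, inner_ket, ket_apply_of_ne hl.symm, mul_zero]
    · intro h
      exact absurd (Fintype.mem_piFinset.mpr fun j => Finset.self_mem_range_succ _) h
  rw [hAg, inner_smul_right, inner_ket, hgn]
  congr 1
  refine Finset.prod_congr rfl fun j _ => ?_
  simp [ha, div_self (hfac (n j))]

/-- The Boltzmann factor of a mode of frequency `x`. -/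
def boltz (β x : ℝ) : ℝ := Real.exp (-(β * x))

theorem boltz_pos (β x : ℝ) : 0 < boltz β x := Real.exp_pos _

theorem boltz_lt_one {β x : ℝ} (hβ : 0 < β) (hx : 0 < x) : boltz β x < 1 :=
  Real.exp_lt_one_iff.mpr (by have := mul_pos hβ hx; linarith)

theorem exp_energy (ω : ι → ℝ) (β : ℝ) (n : ι → ℕ) :
    Real.exp (-(β * energy ω n)) = ∏ j, boltz β (ω j) ^ n j := by
  simp only [boltz, ← Real.exp_nat_mul, ← Real.exp_sum, energy]
  congr 1
  rw [Finset.mul_sum, ← Finset.sum_neg_distrib]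
  exact Finset.sum_congr rfl fun j _ => by ring

variable {ω : ι → ℝ} {β : ℝ}

theorem boltzmann_expVec (hω : ∀ j, 0 < ω j) (hβ : 0 < β) (z : ι → ℂ) :
    boltzmann ω β (expVec z) = expVec (fun j => (boltz β (ω j) : ℂ) * z j) := by
  have h : boltzmann ω β = GaussianThermo.diagonal
      (fun n => ∏ j, (boltz β (ω j) : ℂ) ^ n j) := by
    rw [boltzmann]
    congr 1
    funext n
    rw [exp_energy]
    push_cast
    rfl
  rw [h, diagonal_expVec _ fun j => ?_]
  · rfl
  · rw [Complex.norm_real, Real.norm_of_nonneg (boltz_pos _ _).le]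
    exact (boltz_lt_one hβ (hω j)).le

theorem boltzmann_apply (hω : ∀ j, 0 < ω j) (hβ : 0 < β) (f : Fock ι)
    (n : ι → ℕ) :
    boltzmann ω β f n = (Real.exp (-(β * energy ω n)) : ℂ) * f n := by
  refine diagonal_apply ⟨1, fun k => ?_⟩ f n
  rw [Complex.norm_real, Real.norm_eq_abs, Real.abs_exp, Real.exp_le_one_iff]
  have := mul_nonneg hβ.le (energy_nonneg hω k)
  linarith

theorem isNuclear_boltzmann (hω : ∀ j, 0 < ω j) (hβ : 0 < β) :
    IsNuclear (fun n => (Real.exp (-(β * energy ω n)) : ℂ) • ket n) ket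
    (boltzmann ω β) := by
  refine ⟨?_, fun x => ?_⟩
  · have h := summable_prod (g := fun j k => boltz β (ω j) ^ k)
      (fun j k => pow_nonneg (boltz_pos _ _).le _)
      (fun j => summable_geometric_of_lt_one (boltz_pos _ _).le (boltz_lt_one hβ (hω j)))
    refine h.congr fun n => ?_
    rw [norm_smul, norm_ket, mul_one, mul_one, Complex.norm_real,
      Real.norm_of_nonneg (Real.exp_pos _).le, exp_energy]
  · refine (hasSum_ket (boltzmann ω β x)).congr_fun fun n => ?_
    rw [boltzmann_apply hω hβ, inner_ket, smul_smul, mul_comm]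

theorem gibbs_mem (hω : ∀ j, 0 < ω j) (hβ : 0 < β) : gibbs ω β ∈ traceClass ι :=
  (traceClass ι).smul_mem _ (isNuclear_boltzmann hω hβ).mem

theorem trace_boltzmann (hω : ∀ j, 0 < ω j) (hβ : 0 < β) :
    HasSum (fun n : ι → ℕ => ∏ j, (boltz β (ω j) : ℂ) ^ n j)
    (trace (boltzmann ω β)) := by
  refine (isNuclear_boltzmann hω hβ).hasSum_trace.2.congr_fun fun n => ?_
  rw [inner_ket, boltzmann_apply hω hβ, ket_apply_self, exp_energy]
  simp

theorem trace_boltzmann_ne_zero (hω : ∀ j, 0 < ω j) (hβ : 0 < β) :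
    trace (boltzmann ω β) ≠ 0 := by
  have hlt : ∀ j, ‖(boltz β (ω j) : ℂ)‖ < 1 := fun j => by
    rw [Complex.norm_real, Real.norm_of_nonneg (boltz_pos _ _).le]
    exact boltz_lt_one hβ (hω j)
  rw [(trace_boltzmann hω hβ).unique (hasSum_prod (g := fun j k => (boltz β (ω j) : ℂ) ^ k)
    fun j => summable_norm_geometric_of_norm_lt_one (hlt j))]
  refine Finset.prod_ne_zero_iff.mpr fun j _ => ?_
  rw [tsum_geometric_of_norm_lt_one (hlt j)]
  refine inv_ne_zero (sub_ne_zero.mpr ?_)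
  exact_mod_cast (boltz_lt_one hβ (hω j)).ne'

/-- The symmetrically ordered variance `(1/2) coth (β x / 2)` of a mode of frequency `x` in its
Gibbs state. -/
def thermalVar (β x : ℝ) : ℝ := 2⁻¹ + boltz β x / (1 - boltz β x)

theorem thermalVar_pos {x : ℝ} (hβ : 0 < β) (hx : 0 < x) : 0 < thermalVar β x := by
  have h1 := boltz_pos β x
  have h2 := sub_pos.mpr (boltz_lt_one hβ hx)
  rw [thermalVar]
  positivity

/-- The characteristic function of `e^{-βH}`. Conjugation with a suitable displacement turns
`e^{-βH} D(ξ)` into an operator that is triangular in the number basis and has, up to a constant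
factor, the same diagonal as `e^{-βH}`; its trace is then immediate. -/
theorem charFun_boltzmann (hω : ∀ j, 0 < ω j) (hβ : 0 < β) (ξ : ι → ℂ) :
    charFun (boltzmann ω β) ξ = trace (boltzmann ω β) *
      Complex.exp (-((∑ j, thermalVar β (ω j) * ‖ξ j‖ ^ 2 : ℝ) : ℂ)) := by
  set c : ι → ℝ := fun j => boltz β (ω j) with hc
  -- the displacement that absorbs `ξ`: it solves `c (ξ + η) = η`
  set η : ι → ℂ := fun j => ((c j / (1 - c j) : ℝ) : ℂ) * ξ j with hη
  have h1c : ∀ j, (1 - c j : ℂ) ≠ 0 := fun j => by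
    have := (sub_pos.mpr (boltz_lt_one hβ (hω j))).ne'
    exact_mod_cast this
  have hsol : ∀ z : ι → ℂ, (fun j => (c j : ℂ) * (z + η + ξ) j) = (fun j => (c j : ℂ) * z j) + η := by
    intro z
    funext j
    have := h1c j
    simp only [hη, Pi.add_apply]
    push_cast
    field_simp
    ring
  set k : ℂ := Complex.exp (-(star ξ ⬝ᵥ ξ) / 2 - star ξ ⬝ᵥ η) with hk
  set ζ : ι → ℂ := fun j => η j + ξ j - (c j : ℂ) * η j with hζ
  have hA : ∀ z, (displacement (-η) * boltzmann ω β * (displacement ξ * displacement η)) (expVec z)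
      = (k * Complex.exp (-(star ζ ⬝ᵥ z))) • expVec (fun j => (c j : ℂ) * z j) := by
    intro z
    simp only [mul_apply_eq_comp, displacement_expVec_dotProduct, map_smul, smul_smul,
      boltzmann_expVec hω hβ, ← Complex.exp_add, hk]
    have h3 := hsol z
    simp only [hc] at h3
    rw [h3, add_neg_cancel_right]
    congr 2
    have h4 : star ζ ⬝ᵥ z = star η ⬝ᵥ z + star ξ ⬝ᵥ z - star η ⬝ᵥ (fun j => (c j : ℂ) * z j) := by
      simp only [dotProduct, ← Finset.sum_add_distrib, ← Finset.sum_sub_distrib]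
      refine Finset.sum_congr rfl fun j _ => ?_
      simp [hζ]
      ring
    rw [h4]
    simp only [star_neg, neg_dotProduct, dotProduct_neg, dotProduct_add, hc]
    ring
  have hmem := (isNuclear_boltzmann hω hβ).mem
  have h1 := hasSum_trace (mul_mem_traceClass hmem (displacement (-η))
    (displacement ξ * displacement η))
  rw [trace_mul_mul hmem, mul_assoc (displacement ξ), displacement_mul_neg, mul_one] at h1
  have h2 := (trace_boltzmann hω hβ).mul_left k
  rw [charFun, h1.unique (h2.congr_fun fun n => inner_ket_of_expVec hA n), mul_comm, hk]
  congr 2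
  push_cast
  simp only [dotProduct, Finset.sum_div, ← Finset.sum_neg_distrib, ← Finset.sum_sub_distrib]
  refine Finset.sum_congr rfl fun j _ => ?_
  rw [← Complex.conj_mul' (ξ j)]
  simp only [hη, thermalVar, Pi.star_apply, Complex.star_def, hc]
  push_cast
  ring

theorem charFun_gibbs (hω : ∀ j, 0 < ω j) (hβ : 0 < β) (ξ : ι → ℂ) :
    charFun (gibbs ω β) ξ =
    Complex.exp (-((∑ j, thermalVar β (ω j) * ‖ξ j‖ ^ 2 : ℝ) : ℂ)) := by
  have h : charFun (gibbs ω β) ξ = (trace (boltzmann ω β))⁻¹ * charFun (boltzmann ω β) ξ := by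
    have h1 := hasSum_trace (mul_mem_traceClass (isNuclear_boltzmann hω hβ).mem 1 (displacement ξ))
    rw [one_mul] at h1
    rw [charFun, gibbs, trace]
    refine (HasSum.tsum_eq ((h1.mul_left (trace (boltzmann ω β))⁻¹).congr_fun fun n => ?_))
    rw [smul_mul_assoc, _root_.smul_apply, inner_smul_right]
  rw [h, charFun_boltzmann hω hβ, inv_mul_cancel_left₀ (trace_boltzmann_ne_zero hω hβ)]

end Gibbs

/-! ### Characteristic functions determine trace-class operators -/

section Injective

variable {ι : Type} [Fintype ι]

open Matrix MeasureTheory Filter Topology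

/-- The complex amplitudes with the given real and imaginary parts. -/
def ofRealParts (v : ι ⊕ ι → ℝ) : ι → ℂ := fun j => v (Sum.inl j) + v (Sum.inr j) * Complex.I

theorem star_ofRealParts_dotProduct (v : ι ⊕ ι → ℝ) :
    star (ofRealParts v) ⬝ᵥ ofRealParts v = ∑ i, (v i : ℂ) ^ 2 := by
  rw [Fintype.sum_sum_type, ← Finset.sum_add_distrib]
  refine Finset.sum_congr rfl fun j _ => ?_
  simp only [ofRealParts, Pi.star_apply, Complex.star_def, map_add, map_mul, Complex.conj_ofReal,
    Complex.conj_I]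
  linear_combination -(v (Sum.inr j) : ℂ) ^ 2 * Complex.I_sq

/-- The matrix element of a displacement operator, weighted by the characteristic function of the
vacuum. -/
def weighted (Φ Ψ : Fock ι) (v : ι ⊕ ι → ℝ) : ℂ :=
  Complex.exp (-(star (ofRealParts v) ⬝ᵥ ofRealParts v) / 2) *
    ⟪Φ, displacement (ofRealParts v) Ψ⟫_ℂ

/-- The exponential in `weighted (expVec w) (expVec z)` has these linear coefficients. -/
def weightedCoeff (w z : ι → ℂ) : ι ⊕ ι → ℂ :=
  Sum.elim (fun j => star (w j) - z j) (fun j => Complex.I * (z j + star (w j)))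

theorem weighted_expVec (w z : ι → ℂ) (v : ι ⊕ ι → ℝ) :
    weighted (expVec w) (expVec z) v = Complex.exp (star w ⬝ᵥ z) *
      Complex.exp (-1 * ∑ i, (v i : ℂ) ^ 2 + ∑ i, weightedCoeff w z i * v i) := by
  have h : ∑ i, weightedCoeff w z i * v i =
      star w ⬝ᵥ ofRealParts v - star (ofRealParts v) ⬝ᵥ z := by
    rw [Fintype.sum_sum_type, ← Finset.sum_add_distrib]
    simp only [dotProduct, ← Finset.sum_sub_distrib]
    refine Finset.sum_congr rfl fun j _ => ?_
    simp only [weightedCoeff, Sum.elim_inl, Sum.elim_inr, ofRealParts, Pi.star_apply,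
      Complex.star_def, map_add, map_mul, Complex.conj_ofReal, Complex.conj_I]
    ring
  rw [weighted, inner_displacement, ← Complex.exp_add, ← Complex.exp_add, h,
    star_ofRealParts_dotProduct]
  congr 1
  ring

/-- The value of the Gaussian integral. -/
def gaussConst (ι : Type) [Fintype ι] : ℂ := (Real.pi : ℂ) ^ (Fintype.card (ι ⊕ ι) / 2 : ℂ)

theorem gaussConst_ne_zero : gaussConst ι ≠ 0 := by
  rw [gaussConst, Ne, Complex.cpow_eq_zero_iff, not_and_or]
  exact Or.inl (by exact_mod_cast Real.pi_ne_zero)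

theorem integrable_weighted_expVec (w z : ι → ℂ) :
    Integrable (weighted (expVec w) (expVec z)) := by
  refine ((GaussianFourier.integrable_cexp_neg_mul_sum_add (b := 1) (by simp)
    (weightedCoeff w z)).const_mul (Complex.exp (star w ⬝ᵥ z))).congr (.of_forall fun v => ?_)
  exact (weighted_expVec w z v).symm

theorem integral_weighted_expVec (w z : ι → ℂ) :
    ∫ v, weighted (expVec w) (expVec z) v =
      gaussConst ι * (⟪expVec w, expVec 0⟫_ℂ * ⟪expVec 0, expVec z⟫_ℂ) := by
  simp only [weighted_expVec]
  rw [integral_const_mul, GaussianFourier.integral_cexp_neg_mul_sum_add (by simp)]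
  have h : (∑ i, weightedCoeff w z i ^ 2) / (4 * 1) = -(star w ⬝ᵥ z) := by
    rw [Fintype.sum_sum_type, ← Finset.sum_add_distrib, Finset.sum_div, dotProduct,
      ← Finset.sum_neg_distrib]
    refine Finset.sum_congr rfl fun j _ => ?_
    simp only [weightedCoeff, Sum.elim_inl, Sum.elim_inr, Pi.star_apply, mul_pow, Complex.I_sq]
    ring
  rw [h, mul_left_comm, ← Complex.exp_add, inner_expVec_dotProduct, inner_expVec_dotProduct]
  simp [gaussConst]

theorem weighted_linearCombination (c d : (ι → ℂ) →₀ ℂ) :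
    weighted (Finsupp.linearCombination ℂ expVec c) (Finsupp.linearCombination ℂ expVec d) =
      fun v => ∑ w ∈ c.support, ∑ z ∈ d.support,
        (starRingEnd ℂ (c w) * d z) * weighted (expVec w) (expVec z) v := by
  funext v
  simp only [weighted, Finsupp.linearCombination_apply, Finsupp.sum, sum_inner, inner_sum, map_sum,
    map_smul, inner_smul_left, inner_smul_right, Finset.mul_sum]
  rw [Finset.sum_comm]
  refine Finset.sum_congr rfl fun w _ => Finset.sum_congr rfl fun z _ => ?_
  ring

theorem integral_weighted_linearCombination (c d : (ι → ℂ) →₀ ℂ) :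
    Integrable (weighted (Finsupp.linearCombination ℂ expVec c)
      (Finsupp.linearCombination ℂ expVec d)) ∧
    ∫ v, weighted (Finsupp.linearCombination ℂ expVec c)
      (Finsupp.linearCombination ℂ expVec d) v =
      gaussConst ι * (⟪Finsupp.linearCombination ℂ expVec c, expVec 0⟫_ℂ *
        ⟪expVec 0, Finsupp.linearCombination ℂ expVec d⟫_ℂ) := by
  have hi := fun w z => integrable_weighted_expVec (ι := ι) w z
  rw [weighted_linearCombination]
  refine ⟨integrable_finsetSum _ fun w _ => integrable_finsetSum _ fun z _ =>
    (hi w z).const_mul _, ?_⟩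
  rw [integral_finsetSum _ fun w _ => integrable_finsetSum _ fun z _ => (hi w z).const_mul _]
  have h := fun w => integral_finsetSum (μ := volume) d.support fun z _ =>
    (hi w z).const_mul (starRingEnd ℂ (c w) * d z)
  simp only [h, integral_const_mul, integral_weighted_expVec]
  simp only [Finsupp.linearCombination_apply, Finsupp.sum, sum_inner, inner_sum, inner_smul_left,
    inner_smul_right]
  rw [Finset.sum_mul_sum, Finset.mul_sum]
  refine Finset.sum_congr rfl fun w _ => ?_
  rw [Finset.mul_sum]
  refine Finset.sum_congr rfl fun z _ => ?_
  ring

theorem norm_weighted_le (Φ Ψ : Fock ι) (v : ι ⊕ ι → ℝ) :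
    ‖weighted Φ Ψ v‖ ≤ Real.exp (-(1 / 2) * ∑ i, v i ^ 2) * (‖Φ‖ * ‖Ψ‖) := by
  rw [weighted, norm_mul, star_ofRealParts_dotProduct, Complex.norm_exp]
  have h1 : (-(∑ i, (v i : ℂ) ^ 2) / 2).re = -(1 / 2) * ∑ i, v i ^ 2 := by
    have : -(∑ i, (v i : ℂ) ^ 2) / 2 = ((-(1 / 2) * ∑ i, v i ^ 2 : ℝ) : ℂ) := by
      push_cast; ring
    rw [this, Complex.ofReal_re]
  rw [h1]
  gcongr
  refine (norm_inner_le_norm _ _).trans_eq ?_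
  rw [Unitary.norm_map (⟨_, displacement_mem_unitary (ofRealParts v)⟩ : unitary (Op ι)) Ψ]

theorem integrable_gauss : Integrable fun v : ι ⊕ ι → ℝ => Real.exp (-(1 / 2) * ∑ i, v i ^ 2) := by
  have h := (GaussianFourier.integrable_cexp_neg_mul_sum_add (ι := ι ⊕ ι) (b := 1 / 2) (by simp)
    0).norm
  refine h.congr (.of_forall fun v => ?_)
  have : -(1 / 2) * ∑ i, (v i : ℂ) ^ 2 + ∑ i, (0 : ι ⊕ ι → ℂ) i * v i
      = ((-(1 / 2) * ∑ i, v i ^ 2 : ℝ) : ℂ) := by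
    push_cast; simp
  simp only [this, Complex.norm_exp, Complex.ofReal_re]

theorem exists_seq_tendsto (Φ : Fock ι) : ∃ c : ℕ → (ι → ℂ) →₀ ℂ,
    Tendsto (fun p => Finsupp.linearCombination ℂ expVec (c p)) atTop (𝓝 Φ) := by
  obtain ⟨x, hx, hlim⟩ := mem_closure_iff_seq_limit.mp (denseRange_expVec Φ)
  choose c hc using hx
  exact ⟨c, by simpa only [hc] using hlim⟩

theorem tendsto_weighted {Φ Ψ : Fock ι} {f g : ℕ → Fock ι} (hf : Tendsto f atTop (𝓝 Φ))
    (hg : Tendsto g atTop (𝓝 Ψ)) (v : ι ⊕ ι → ℝ) :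
    Tendsto (fun p => weighted (f p) (g p) v) atTop (𝓝 (weighted Φ Ψ v)) := by
  have h1 : Tendsto (fun p => displacement (ofRealParts v) (g p)) atTop
      (𝓝 (displacement (ofRealParts v) Ψ)) :=
    ((displacement (ofRealParts v)).continuous.tendsto Ψ).comp hg
  have h2 : Tendsto (fun p => ⟪f p, displacement (ofRealParts v) (g p)⟫_ℂ) atTop
      (𝓝 ⟪Φ, displacement (ofRealParts v) Ψ⟫_ℂ) := hf.inner h1
  exact h2.const_mul _

theorem integral_weighted_of_tendsto {Φ Ψ : Fock ι} {f g : ℕ → Fock ι}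
    (hf : Tendsto f atTop (𝓝 Φ)) (hg : Tendsto g atTop (𝓝 Ψ))
    (hint : ∀ p, Integrable (weighted (f p) (g p)) ∧ ∫ v, weighted (f p) (g p) v =
      gaussConst ι * (⟪f p, expVec 0⟫_ℂ * ⟪expVec 0, g p⟫_ℂ)) :
    AEStronglyMeasurable (weighted Φ Ψ) ∧
      ∫ v, weighted Φ Ψ v = gaussConst ι * (⟪Φ, expVec 0⟫_ℂ * ⟪expVec 0, Ψ⟫_ℂ) := by
  have hlim := tendsto_weighted hf hg
  obtain ⟨M, hM⟩ : ∃ M, ∀ p, ‖f p‖ * ‖g p‖ ≤ M := by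
    obtain ⟨M, hM⟩ := (hf.norm.mul hg.norm).bddAbove_range
    exact ⟨M, fun p => hM ⟨p, rfl⟩⟩
  have hmeas := fun p => (hint p).1.aestronglyMeasurable
  refine ⟨aestronglyMeasurable_of_tendsto_ae atTop hmeas (.of_forall hlim), ?_⟩
  have hb : ∀ p v, ‖weighted (f p) (g p) v‖ ≤ Real.exp (-(1 / 2) * ∑ i, v i ^ 2) * M :=
    fun p v => (norm_weighted_le _ _ v).trans
      (mul_le_mul_of_nonneg_left (hM p) (Real.exp_pos _).le)
  have hi : Integrable fun v : ι ⊕ ι → ℝ => Real.exp (-(1 / 2) * ∑ i, v i ^ 2) * M :=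
    integrable_gauss.mul_const M
  have h1 : Tendsto (fun p => ∫ v, weighted (f p) (g p) v) atTop (𝓝 (∫ v, weighted Φ Ψ v)) :=
    tendsto_integral_of_dominated_convergence _ hmeas hi (fun p => .of_forall (hb p))
      (.of_forall hlim)
  have h2 : Tendsto (fun p => ⟪f p, expVec 0⟫_ℂ) atTop (𝓝 ⟪Φ, expVec 0⟫_ℂ) :=
    hf.inner tendsto_const_nhds
  have h3 : Tendsto (fun p => ⟪expVec 0, g p⟫_ℂ) atTop (𝓝 ⟪expVec 0, Ψ⟫_ℂ) :=
    tendsto_const_nhds.inner hg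
  exact tendsto_nhds_unique (h1.congr fun p => (hint p).2) ((h2.mul h3).const_mul _)

/-- The projection on the vacuum is a Gaussian average of displacement operators. -/
theorem integral_weighted (Φ Ψ : Fock ι) :
    AEStronglyMeasurable (weighted Φ Ψ) ∧
      ∫ v, weighted Φ Ψ v = gaussConst ι * (⟪Φ, expVec 0⟫_ℂ * ⟪expVec 0, Ψ⟫_ℂ) := by
  obtain ⟨c, hc⟩ := exists_seq_tendsto Φ
  obtain ⟨d, hd⟩ := exists_seq_tendsto Ψ
  exact integral_weighted_of_tendsto hc hd
    fun p => integral_weighted_linearCombination (c p) (d p)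

/-- Only countably many terms of a nuclear decomposition are nonzero, so that the sum may be exchanged
with integrals. -/
theorem exists_isNuclear_countable {ι : Type} {T : Op ι} (hT : T ∈ traceClass ι) :
    ∃ (I : Type) (_ : Countable I) (u v : I → Fock ι), IsNuclear u v T := by
  obtain ⟨I, u, v, hn⟩ := exists_isNuclear hT
  refine ⟨Function.support fun i => ‖u i‖ * ‖v i‖, hn.1.countable_support, fun i => u i,
    fun i => v i, hn.1.subtype _, fun x => ?_⟩
  refine (hasSum_subtype_iff_of_support_subset (f := fun i => ⟪v i, x⟫_ℂ • u i)
    fun i hi => ?_).mpr (hn.2 x)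
  contrapose! hi
  rcases mul_eq_zero.mp (Function.notMem_support.mp hi) with h | h
  · simp [norm_eq_zero.mp h]
  · simp [norm_eq_zero.mp h]

theorem inner_vacuum_eq_zero {T : Op ι} (hT : T ∈ traceClass ι) (h : ∀ ξ, charFun T ξ = 0) :
    ⟪expVec 0, T (expVec 0)⟫_ℂ = 0 := by
  obtain ⟨I, _, u, v, hn⟩ := exists_isNuclear_countable hT
  have hg := integrable_gauss (ι := ι)
  have h1 := hasSum_integral_of_dominated_convergence (μ := volume)
    (F := fun i => weighted (v i) (u i)) (f := fun _ => (0 : ℂ))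
    (fun i x => Real.exp (-(1 / 2) * ∑ j, x j ^ 2) * (‖v i‖ * ‖u i‖))
    (fun i => (integral_weighted _ _).1) (fun i => .of_forall (norm_weighted_le _ _))
    (.of_forall fun x => (hn.1.mul_left _).congr fun i => by rw [mul_comm ‖u i‖])
    (by simpa only [tsum_mul_left] using hg.mul_const _)
    (.of_forall fun x => by
      have h2 := hn.hasSum_trace_mul_right (displacement (ofRealParts x))
      have h3 : trace (T * displacement (ofRealParts x)) = 0 := h _
      rw [h3] at h2
      simpa only [mul_zero, weighted] using
        h2.mul_left (Complex.exp (-(star (ofRealParts x) ⬝ᵥ ofRealParts x) / 2)))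
  simp only [(integral_weighted _ _).2, integral_zero] at h1
  have h4 := (hn.hasSum_inner (expVec 0) (expVec 0)).mul_left (gaussConst ι)
  exact (mul_eq_zero.mp (h4.unique h1)).resolve_left gaussConst_ne_zero

theorem trace_smul {ι : Type} (c : ℂ) (T : Op ι) : trace (c • T) = c * trace T := by
  simp only [trace, _root_.smul_apply, inner_smul_right, tsum_mul_left]

theorem trace_sub {ι : Type} {T S : Op ι} (hT : T ∈ traceClass ι) (hS : S ∈ traceClass ι) :
    trace (T - S) = trace T - trace S := by
  refine HasSum.tsum_eq (((hasSum_trace hT).sub (hasSum_trace hS)).congr_fun fun n => ?_)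
  rw [_root_.sub_apply, inner_sub_right]

/-- The displacement operators move the vacuum to all coherent states, so that every matrix element
between coherent vectors is a vacuum expectation of a displaced operator. -/
theorem eq_zero_of_charFun {T : Op ι} (hT : T ∈ traceClass ι) (h : ∀ ξ, charFun T ξ = 0) :
    T = 0 := by
  have key : ∀ a b : ι → ℂ, ⟪displacement a (expVec 0), T (displacement b (expVec 0))⟫_ℂ = 0 := by
    intro a b
    have h1 := inner_vacuum_eq_zero
      (mul_mem_traceClass hT (displacement (-a)) (displacement b)) fun ξ => ?_
    · rwa [← star_displacement, mul_apply_eq_comp, mul_apply_eq_comp,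
        ContinuousLinearMap.star_eq_adjoint, ContinuousLinearMap.adjoint_inner_right] at h1
    · rw [charFun, mul_assoc, trace_mul_mul hT, displacement_mul, smul_mul_assoc, displacement_mul,
        smul_smul, mul_smul_comm, trace_smul]
      exact mul_eq_zero_of_right _ (h _)
  refine op_ext_inner fun w z => ?_
  have h2 : ∀ z : ι → ℂ, expVec z =
      Complex.exp ((star z ⬝ᵥ z) / 2) • displacement z (expVec 0) := by
    intro z
    rw [displacement_expVec_dotProduct, smul_smul, ← Complex.exp_add]
    simp [neg_div]
  rw [h2 w, h2 z, map_smul, inner_smul_left, inner_smul_right, key]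
  simp

/-- A trace-class operator is determined by its characteristic function. -/
theorem eq_of_charFun_eq {T S : Op ι} (hT : T ∈ traceClass ι) (hS : S ∈ traceClass ι)
    (h : ∀ ξ, charFun T ξ = charFun S ξ) : T = S := by
  refine sub_eq_zero.mp (eq_zero_of_charFun ((traceClass ι).sub_mem hT hS) fun ξ => ?_)
  have hm : ∀ {R : Op ι}, R ∈ traceClass ι → R * displacement ξ ∈ traceClass ι := fun hR => by
    simpa using mul_mem_traceClass hR 1 (displacement ξ)
  rw [charFun, sub_mul, trace_sub (hm hT) (hm hS)]
  exact sub_eq_zero.mpr (h ξ)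

end Injective

/-! ### Singular value decomposition by unitaries that respect the resonances -/

section SVD

open Matrix

theorem exists_svd {n : Type} [Fintype n] [DecidableEq n] (K : Matrix n n ℂ) :
    ∃ (A B : unitaryGroup n ℂ) (s : n → ℝ), (∀ j, 0 ≤ s j) ∧
      K = (A : Matrix n n ℂ) * Matrix.diagonal (fun j => (s j : ℂ)) * (B : Matrix n n ℂ) := by
  have hH : (Kᴴ * K).IsHermitian := isHermitian_conjTranspose_mul_self K
  have hpos : (Kᴴ * K).PosSemidef := posSemidef_conjTranspose_mul_self K
  set q := hH.eigenvectorBasis with hq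
  set s : n → ℝ := fun j => Real.sqrt (hH.eigenvalues j) with hs
  set y : n → EuclideanSpace ℂ n := fun j => WithLp.toLp 2 (K *ᵥ (q j).ofLp) with hy
  have hsq : ∀ j, ((s j : ℂ)) * s j = hH.eigenvalues j := fun j => by
    rw [← Complex.ofReal_mul, Real.mul_self_sqrt (hpos.eigenvalues_nonneg j)]
  have hinner : ∀ i j, ⟪y i, y j⟫_ℂ = if i = j then (s j : ℂ) * s j else 0 := by
    intro i j
    have h1 : ⟪y i, y j⟫_ℂ = ⟪q i, WithLp.toLp 2 ((Kᴴ * K) *ᵥ (q j).ofLp)⟫_ℂ := by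
      simp only [EuclideanSpace.inner_eq_star_dotProduct, hy]
      rw [← mulVec_mulVec, star_mulVec, dotProduct_comm, ← dotProduct_mulVec, dotProduct_comm _ (star _)]
    have h2 : WithLp.toLp 2 ((Kᴴ * K) *ᵥ (q j).ofLp) = (hH.eigenvalues j : ℂ) • q j := by
      rw [hq, hH.mulVec_eigenvectorBasis]
      rfl
    rw [h1, h2, hsq, inner_smul_right, orthonormal_iff_ite.mp q.orthonormal i j]
    split_ifs with h
    · rw [mul_one]
    · rw [mul_zero]
  -- the images of the eigenvectors of `K† K` are orthogonal; the nonzero ones are normalized and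
  -- completed to an orthonormal basis
  obtain ⟨b, hb⟩ := Orthonormal.exists_orthonormalBasis_extension_of_card_eq
    (𝕜 := ℂ) (E := EuclideanSpace ℂ n) (ι := n) (by simp)
    (v := fun j => (s j : ℂ)⁻¹ • y j) (s := {j | s j ≠ 0}) (by
      rw [orthonormal_iff_ite]
      rintro ⟨i, hi⟩ ⟨j, hj⟩
      have hi' : (s i : ℂ) ≠ 0 := by exact_mod_cast hi
      simp only [Set.domRestrict_apply, inner_smul_left, inner_smul_right, hinner, map_inv₀,
        Complex.conj_ofReal, Subtype.mk.injEq]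
      split_ifs with h
      · subst h
        field_simp
      · simp)
  have hyb : ∀ j, y j = (s j : ℂ) • b j := by
    intro j
    by_cases h : s j = 0
    · have h2 := hinner j j
      rw [if_pos rfl, h] at h2
      rw [h, inner_self_eq_zero.mp (h2.trans (by simp))]
      simp
    · rw [hb j h, smul_smul, mul_inv_cancel₀ (by exact_mod_cast h), one_smul]
  have hA := (EuclideanSpace.basisFun n ℂ).toMatrix_orthonormalBasis_mem_unitary b
  set A : unitaryGroup n ℂ := ⟨_, hA⟩
  refine ⟨A, star hH.eigenvectorUnitary, s, fun j => Real.sqrt_nonneg _, ?_⟩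
  have hKQ : K * (hH.eigenvectorUnitary : Matrix n n ℂ) =
      (A : Matrix n n ℂ) * Matrix.diagonal (fun j => (s j : ℂ)) := by
    ext i j
    have h3 := congrArg (fun v : EuclideanSpace ℂ n => v.ofLp i) (hyb j)
    rw [Matrix.mul_diagonal, mul_comm]
    exact h3
  rw [← hKQ, Matrix.mul_assoc]
  simp

/-- A matrix that is block diagonal along the fibers of `f` has a singular value decomposition by
unitaries with the same block structure. -/
theorem exists_svd_of_fibers {ι o : Type} [Fintype ι] [DecidableEq ι] [Fintype o] [DecidableEq o]
    (f : ι → o) (K : Matrix ι ι ℂ) (hK : ∀ i j, K i j ≠ 0 → f i = f j) :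
    ∃ (A B : unitaryGroup ι ℂ) (s : ι → ℝ), (∀ j, 0 ≤ s j) ∧
      (∀ i j, (A : Matrix ι ι ℂ) i j ≠ 0 → f i = f j) ∧
      (∀ i j, (B : Matrix ι ι ℂ) i j ≠ 0 → f i = f j) ∧
      K = (A : Matrix ι ι ℂ) * Matrix.diagonal (fun j => (s j : ℂ)) * (B : Matrix ι ι ℂ) := by
  choose A B s hs hABs using fun w : o =>
    exists_svd (K.submatrix (Subtype.val : {i // f i = w} → ι) Subtype.val)
  set e := (Equiv.sigmaFiberEquiv f).symm with he
  have hU : ∀ A : ∀ w, unitaryGroup {i // f i = w} ℂ,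
      (blockDiagonal' fun w => (A w : Matrix {i // f i = w} {i // f i = w} ℂ)).submatrix e e ∈ unitaryGroup ι ℂ := by
    intro A
    rw [mem_unitaryGroup_iff, star_eq_conjTranspose, conjTranspose_submatrix,
      submatrix_mul_equiv, blockDiagonal'_conjTranspose, ← blockDiagonal'_mul]
    have h : (fun w => (A w : Matrix {i // f i = w} {i // f i = w} ℂ) * (A w : Matrix _ _ ℂ)ᴴ) = 1 := by
      funext w
      rw [← star_eq_conjTranspose]
      exact Unitary.mul_star_self_of_mem (A w).2
    rw [h, blockDiagonal'_one, submatrix_one_equiv]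
  have hR : ∀ A : ∀ w, Matrix {i // f i = w} {i // f i = w} ℂ, ∀ i j,
      (blockDiagonal' A).submatrix e e i j ≠ 0 → f i = f j := by
    intro A i j h
    contrapose! h
    exact blockDiagonal'_apply_ne A _ _ h
  refine ⟨⟨_, hU A⟩, ⟨_, hU B⟩, fun j => s (e j).1 (e j).2, fun j => hs _ _, hR _, hR _, ?_⟩
  have hD : Matrix.diagonal (fun j => (s (e j).1 (e j).2 : ℂ)) =
      (blockDiagonal' fun w => Matrix.diagonal fun j => (s w j : ℂ)).submatrix e e := by
    rw [blockDiagonal'_diagonal, submatrix_diagonal_equiv]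
    rfl
  rw [hD, submatrix_mul_equiv, submatrix_mul_equiv, ← blockDiagonal'_mul, ← blockDiagonal'_mul]
  have h : K.submatrix e.symm e.symm =
      blockDiagonal' fun w => K.submatrix (Subtype.val : {i // f i = w} → ι) Subtype.val := by
    ext ⟨w, i, hi⟩ ⟨w', j, hj⟩
    by_cases hw : w = w'
    · subst hw
      rw [blockDiagonal'_apply_eq]
      rfl
    · rw [blockDiagonal'_apply_ne _ _ _ hw]
      by_contra hne
      exact hw (hi.symm.trans ((hK i j hne).trans hj))
  simp only [← hABs, ← h]
  rw [submatrix_submatrix]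
  simp

theorem Resonant.exists_svd {ι : Type} [Fintype ι] [DecidableEq ι] {ω : ι → ℝ} {K : Matrix ι ι ℂ}
    (hK : Resonant ω K) : ∃ (A B : unitaryGroup ι ℂ) (s : ι → ℝ), (∀ j, 0 ≤ s j) ∧
      Resonant ω (A : Matrix ι ι ℂ) ∧ Resonant ω (B : Matrix ι ι ℂ) ∧
      K = (A : Matrix ι ι ℂ) * Matrix.diagonal (fun j => (s j : ℂ)) * (B : Matrix ι ι ℂ) := by
  classical
  have hf : ∀ i j, Set.rangeFactorization ω i = Set.rangeFactorization ω j ↔ ω i = ω j :=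
    fun i j => Subtype.ext_iff
  obtain ⟨A, B, s, hs, hA, hB, h⟩ := exists_svd_of_fibers (Set.rangeFactorization ω) K
    fun i j h => (hf i j).mpr (hK i j h)
  exact ⟨A, B, s, hs, fun i j h => (hf i j).mp (hA i j h), fun i j h => (hf i j).mp (hB i j h), h⟩

end SVD

/-! ### Dilations by second-quantized unitaries -/

theorem exists_isTensor {ι κ : Type} {T : Op ι} {S : Op κ} (hT : T ∈ traceClass ι) (hS : S ∈ traceClass κ) :
    ∃ P : Op (ι ⊕ κ), IsTensor P T S := by
  obtain ⟨I, u, v, hu⟩ := exists_isNuclear hT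
  obtain ⟨J, a, b, ha⟩ := exists_isNuclear hS
  obtain ⟨P, hP, -⟩ := hu.tensor ha
  exact ⟨P, hP⟩

section Dilation

variable {ι κ : Type} [Fintype ι] [Fintype κ]

open Matrix

/-- The characteristic function of the output of a dilated channel is that of the evolved composite
state, restricted to the system. -/
theorem IsDilation.charFun_eq {U : Op (ι ⊕ κ)} {σ : Op κ} {E : Channel ι ι} (h : IsDilation U σ E)
    (hσ : σ ∈ traceClass κ) {T : traceClass ι} {P : Op (ι ⊕ κ)} (hP : IsTensor P (T : Op ι) σ)
    (ξ : ι → ℂ) :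
    charFun (E.map T : Op ι) ξ = charFun (U * P * star U) (Sum.elim ξ 0) := by
  obtain ⟨P', hP', hQ⟩ := h T
  obtain rfl := hP.unique hP'
  obtain ⟨Q, hQ', hc⟩ := exists_partialTrace
    (mul_mem_traceClass (hP.mem_traceClass T.2 hσ) U (star U))
  rw [hQ.unique hQ', hc]

/-- A channel is dilated by the second quantization of `V` as soon as it acts on characteristic
functions in the way prescribed by `V`. -/
theorem isDilation_secondQuant [DecidableEq ι] [DecidableEq κ] (V : unitaryGroup (ι ⊕ κ) ℂ)
    {σ : Op κ} (hσ : σ ∈ traceClass κ) (E : Channel ι ι)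
    (h : ∀ (T : traceClass ι) (ξ : ι → ℂ), charFun (E.map T : Op ι) ξ =
      charFun (T : Op ι) (((star V : Matrix (ι ⊕ κ) (ι ⊕ κ) ℂ) *ᵥ Sum.elim ξ 0) ∘ Sum.inl) *
      charFun σ (((star V : Matrix (ι ⊕ κ) (ι ⊕ κ) ℂ) *ᵥ Sum.elim ξ 0) ∘ Sum.inr)) :
    IsDilation (secondQuant V) σ E := by
  intro T
  obtain ⟨P, hP⟩ := exists_isTensor T.2 hσ
  have hmem := hP.mem_traceClass T.2 hσ
  refine ⟨P, hP, ?_⟩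
  obtain ⟨Q, hQ, hc⟩ := exists_partialTrace
    (mul_mem_traceClass hmem (secondQuant V) (star (secondQuant V)))
  have hQE : (Q : Op ι) = E.map T := by
    refine eq_of_charFun_eq Q.2 (E.map T).2 fun ξ => ?_
    rw [hc, h, ← hP.charFun_eq T.2 hσ, Sum.elim_comp_inl_inr]
    exact charFun_conj_secondQuant V ⟨P, hmem⟩ _
  rw [← hQE]
  exact hQ

/-- The quadratic form of the Gibbs state. -/
def thermalSum (ω : ι → ℝ) (β : ℝ) (ξ : ι → ℂ) : ℝ := ∑ j, thermalVar β (ω j) * ‖ξ j‖ ^ 2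

theorem thermalSum_eq_dotProduct [DecidableEq ι] (ω : ι → ℝ) (β : ℝ) (ξ : ι → ℂ) :
    (thermalSum ω β ξ : ℂ) =
      star ξ ⬝ᵥ (Matrix.diagonal (fun j => ((thermalVar β (ω j) : ℝ) : ℂ)) *ᵥ ξ) := by
  rw [thermalSum, dotProduct]
  push_cast
  refine Finset.sum_congr rfl fun j _ => ?_
  rw [mulVec_diagonal, ← Complex.conj_mul' (ξ j), Pi.star_apply, Complex.star_def]
  ring

/-- Resonant unitaries preserve the quadratic form of the Gibbs state, since the variance of a mode
depends on its frequency only. -/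
theorem thermalSum_mulVec [DecidableEq ι] {ω : ι → ℝ} {V : unitaryGroup ι ℂ}
    (hV : Resonant ω (V : Matrix ι ι ℂ)) (β : ℝ) (ξ : ι → ℂ) :
    thermalSum ω β ((V : Matrix ι ι ℂ) *ᵥ ξ) = thermalSum ω β ξ := by
  have h := hV.mul_diagonal fun x => ((thermalVar β x : ℝ) : ℂ)
  have h2 : (thermalSum ω β ((V : Matrix ι ι ℂ) *ᵥ ξ) : ℂ) = thermalSum ω β ξ := by
    rw [thermalSum_eq_dotProduct, thermalSum_eq_dotProduct, mulVec_mulVec, ← h, ← mulVec_mulVec,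
      dotProduct_unitary]
  exact_mod_cast h2

end Dilation

section Mixer

variable {ι κ : Type} [Fintype ι] [Fintype κ] [DecidableEq ι] [DecidableEq κ]

open Matrix

/-- The coupling of the ancilla mode `k` to the system mode `p k`, with strength `c (p k)`. -/
def coupling {ι κ : Type} [DecidableEq ι] (p : κ → ι) (c : ι → ℝ) : Matrix ι κ ℂ :=
  Matrix.of fun i k => if i = p k then (c i : ℂ) else 0

theorem coupling_mul_conjTranspose {ι κ : Type} [Fintype κ] [DecidableEq ι] {p : κ → ι}
    (hp : Function.Injective p) {c : ι → ℝ} (hc : ∀ i, i ∉ Set.range p → c i = 0) :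
    coupling p c * (coupling p c)ᴴ = Matrix.diagonal fun i => (c i : ℂ) ^ 2 := by
  ext i i'
  rw [mul_apply]
  by_cases hi : i ∈ Set.range p
  · obtain ⟨k, rfl⟩ := hi
    rw [Finset.sum_eq_single k]
    · by_cases h : p k = i'
      · subst h
        simp [coupling, sq]
      · simp [coupling, h, Ne.symm h]
    · intro l _ hl
      simp [coupling, hp.ne hl.symm]
    · simp
  · have h0 := hc i hi
    have h1 : ∀ k, i ≠ p k := fun k h => hi ⟨k, h.symm⟩
    rw [Finset.sum_eq_zero fun k _ => by simp [coupling, h1]]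
    by_cases h : i = i'
    · subst h; simp [h0]
    · simp [h]

theorem conjTranspose_mul_coupling {ι κ : Type} [Fintype ι] [DecidableEq ι] [DecidableEq κ]
    {p : κ → ι} (hp : Function.Injective p) (c : ι → ℝ) :
    (coupling p c)ᴴ * coupling p c = Matrix.diagonal fun k => (c (p k) : ℂ) ^ 2 := by
  ext k k'
  rw [mul_apply, Finset.sum_eq_single (p k)]
  · by_cases h : k = k'
    · subst h; simp [coupling, sq]
    · simp [coupling, h, hp.ne h]
  · intro l _ hl
    simp [coupling, hl]
  · simp

theorem diagonal_mul_coupling (p : κ → ι) (c s : ι → ℝ) :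
    Matrix.diagonal (fun i => (s i : ℂ)) * coupling p c =
      coupling p c * Matrix.diagonal fun k => (s (p k) : ℂ) := by
  ext i k
  rw [Matrix.diagonal_mul, Matrix.mul_diagonal]
  by_cases h : i = p k
  · rw [h, mul_comm]
  · simp [coupling, h]

/-- The matrix that mixes each ancilla mode `k` with the system mode `p k` on a beam splitter with
transmission amplitude `s (p k)` and reflection amplitude `c (p k)`. -/
def mixer {ι κ : Type} [DecidableEq ι] [DecidableEq κ] (p : κ → ι) (s c : ι → ℝ) :
    Matrix (ι ⊕ κ) (ι ⊕ κ) ℂ :=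
  Matrix.fromBlocks (Matrix.diagonal fun i => (s i : ℂ)) (coupling p c)
    (-(coupling p c)ᴴ) (Matrix.diagonal fun k => (s (p k) : ℂ))

theorem mixer_mem_unitaryGroup {p : κ → ι} (hp : Function.Injective p) {s c : ι → ℝ}
    (hc : ∀ i, i ∉ Set.range p → c i = 0) (hsc : ∀ i, s i ^ 2 + c i ^ 2 = 1) :
    mixer p s c ∈ unitaryGroup (ι ⊕ κ) ℂ := by
  have hsc' : ∀ i, (s i : ℂ) * s i + (c i : ℂ) ^ 2 = 1 := fun i => by
    rw [← sq]; exact_mod_cast hsc i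
  have hsc'' : ∀ i, (c i : ℂ) ^ 2 + (s i : ℂ) * s i = 1 := fun i => by rw [add_comm, hsc']
  have hstar : ∀ {n : Type} (s : n → ℝ), (star fun i => (s i : ℂ)) = fun i => (s i : ℂ) :=
    fun s => funext fun i => Complex.conj_ofReal _
  rw [mem_unitaryGroup_iff, star_eq_conjTranspose, mixer, fromBlocks_conjTranspose,
    fromBlocks_multiply, diagonal_conjTranspose, diagonal_conjTranspose, conjTranspose_neg,
    conjTranspose_conjTranspose, hstar, hstar]
  simp only [Matrix.mul_neg, Matrix.neg_mul, neg_neg, diagonal_mul_coupling,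
    coupling_mul_conjTranspose hp hc, conjTranspose_mul_coupling hp, diagonal_mul_diagonal,
    diagonal_add, hsc', hsc'']
  have h := congrArg conjTranspose (diagonal_mul_coupling p c s)
  rw [conjTranspose_mul, conjTranspose_mul, diagonal_conjTranspose, diagonal_conjTranspose, hstar,
    hstar] at h
  rw [h]
  simp

theorem resonant_mixer {ι κ : Type} [DecidableEq ι] [DecidableEq κ] (p : κ → ι) (s c ω : ι → ℝ) :
    Resonant (Sum.elim ω (ω ∘ p)) (mixer p s c) := by
  rintro (i | k) (j | l) h
  · by_contra hne
    have hij : i ≠ j := fun h => hne (by rw [h])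
    exact h (by simp [mixer, hij])
  · by_contra hne
    have hil : i ≠ p l := fun h => hne (by simp [h])
    exact h (by simp [mixer, coupling, hil])
  · by_contra hne
    have hjk : j ≠ p k := fun h => hne (by simp [h])
    exact h (by simp [mixer, coupling, hjk])
  · by_contra hne
    have hkl : k ≠ l := fun h => hne (by rw [h])
    exact h (by simp [mixer, hkl])

theorem star_mixer_mulVec {p : κ → ι} (s c : ι → ℝ) (ξ : ι → ℂ) :
    (star (mixer p s c) : Matrix (ι ⊕ κ) (ι ⊕ κ) ℂ) *ᵥ Sum.elim ξ 0 =
      Sum.elim (fun i => (s i : ℂ) * ξ i) (fun k => (c (p k) : ℂ) * ξ (p k)) := by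
  rw [star_eq_conjTranspose, mixer, fromBlocks_conjTranspose, fromBlocks_mulVec]
  simp only [Sum.elim_comp_inl, Sum.elim_comp_inr, mulVec_zero, add_zero]
  congr 1
  · funext i
    rw [diagonal_conjTranspose, mulVec_diagonal, Pi.star_apply, Complex.star_def,
      Complex.conj_ofReal]
  · funext k
    rw [mulVec, dotProduct, Finset.sum_eq_single (p k)]
    · simp [coupling]
    · intro i _ hi
      simp [coupling, hi]
    · simp

/-- The noise that the thermal ancillas feed into the system is exactly what the damping of the system
modes takes from the Gibbs state. -/
theorem thermalSum_mixer {ι κ : Type} [Fintype ι] [Fintype κ] [DecidableEq ι] {p : κ → ι}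
    (hp : Function.Injective p) {s c : ι → ℝ} (hc : ∀ i, i ∉ Set.range p → c i = 0)
    (hsc : ∀ i, s i ^ 2 + c i ^ 2 = 1) (ω : ι → ℝ) (β : ℝ)
    (ξ : ι → ℂ) : thermalSum (ω ∘ p) β (fun k => (c (p k) : ℂ) * ξ (p k)) =
      thermalSum ω β ξ - thermalSum ω β (fun i => (s i : ℂ) * ξ i) := by
  simp only [thermalSum, norm_mul, mul_pow, Complex.norm_real, Real.norm_eq_abs, sq_abs,
    ← Finset.sum_sub_distrib, Function.comp_apply]
  rw [← Finset.sum_image (s := Finset.univ) (g := p)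
    (f := fun i => thermalVar β (ω i) * (c i ^ 2 * ‖ξ i‖ ^ 2)) hp.injOn]
  refine Finset.sum_subset_zero_on_sdiff (Finset.subset_univ _) (fun i hi => ?_) fun i _ => ?_
  · have h0 := hc i (by simpa using hi)
    have h1 := hsc i
    rw [h0] at h1
    linear_combination (-(thermalVar β (ω i) * ‖ξ i‖ ^ 2)) * h1
  · linear_combination (thermalVar β (ω i) * ‖ξ i‖ ^ 2) * hsc i

theorem beamSplitter_eq_mixer {ι : Type} [DecidableEq ι] (J : Finset ι) (η : ι → ℝ) :
    beamSplitter J η = mixer (fun j : J => (j : ι)) (fun i => if i ∈ J then Real.sqrt (η i) else 1)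
      (fun i => if i ∈ J then Real.sqrt (1 - η i) else 0) := by
  rw [beamSplitter, mixer]
  congr 1
  · congr 1
    funext i
    split_ifs <;> simp
  · ext i j
    by_cases h : i = j.1
    · simp [coupling, h]
    · simp [coupling, h]
  · ext j i
    by_cases h : i = j.1
    · simp [coupling, h]
    · simp [coupling, h]
  · congr 1
    funext j
    simp

/-- The action of a unitary on the first summand only. -/
def inlUnitary (κ : Type) [Fintype κ] [DecidableEq κ] (W : unitaryGroup ι ℂ) :
    unitaryGroup (ι ⊕ κ) ℂ :=
  ⟨Matrix.fromBlocks W 0 0 1, by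
    rw [mem_unitaryGroup_iff, star_eq_conjTranspose, fromBlocks_conjTranspose,
      fromBlocks_multiply, ← star_eq_conjTranspose]
    simp⟩

theorem star_inlUnitary_mulVec (W : unitaryGroup ι ℂ) (ξ : ι → ℂ) (ζ : κ → ℂ) :
    (star (inlUnitary κ W) : Matrix (ι ⊕ κ) (ι ⊕ κ) ℂ) *ᵥ Sum.elim ξ ζ =
      Sum.elim ((star W : Matrix ι ι ℂ) *ᵥ ξ) ζ := by
  change (Matrix.fromBlocks (W : Matrix ι ι ℂ) 0 0 1)ᴴ *ᵥ _ = _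
  rw [fromBlocks_conjTranspose, fromBlocks_mulVec]
  simp [star_eq_conjTranspose]

theorem Resonant.inlUnitary {W : unitaryGroup ι ℂ} {ω : ι → ℝ}
    (hW : Resonant ω (W : Matrix ι ι ℂ)) (ν : κ → ℝ) :
    Resonant (Sum.elim ω ν) (inlUnitary κ W : Matrix (ι ⊕ κ) (ι ⊕ κ) ℂ) := by
  rintro (i | k) (j | l) h
  · exact hW i j h
  · exact absurd rfl h
  · exact absurd rfl h
  · by_contra hne
    exact h (one_apply_ne fun h => hne (by simp [h]))

end Mixer

/-! ### Thermal operations are covariant Gaussian channels that fix the Gibbs state -/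

theorem clm_ext_ket {ι : Type} {A B : Op ι} (h : ∀ n k, A (ket n) k = B (ket n) k) : A = B := by
  have h1 : ∀ n, A (ket n) = B (ket n) := fun n => lp.ext (funext (h n))
  refine ContinuousLinearMap.ext fun f => ?_
  have h2 := (hasSum_ket f).mapL A
  have h3 := (hasSum_ket f).mapL B
  simp only [map_smul, h1] at h2 h3
  exact h2.unique h3

section Thermal

variable {ι κ : Type} [Fintype ι] [Fintype κ]

open Matrix

/-- Conjugation with the adjoint of a Gaussian unitary is again a linear substitution of
displacements, because symplectic maps are invertible. -/
theorem IsGaussianUnitary.exists_inverse {U : Op ι} (hU : IsGaussianUnitary U) :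
    ∃ (S : (ι → ℂ) →ₗ[ℝ] (ι → ℂ)) (δ : (ι → ℂ) →ₗ[ℝ] ℝ), ∀ ξ : ι → ℂ,
      star U * displacement ξ * U = Complex.exp (Complex.I * (δ ξ : ℂ)) • displacement (S ξ) := by
  obtain ⟨hU, S, δ, hS, hD⟩ := hU
  have hinj : Function.Injective S := by
    refine (injective_iff_map_eq_zero S).mpr fun ξ hξ => ?_
    have h := hS ξ (fun j => Complex.I * ξ j)
    rw [hξ] at h
    have h2 : (∑ j, star (ξ j) * (Complex.I * ξ j)).im = ∑ j, ‖ξ j‖ ^ 2 := by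
      rw [Complex.im_sum]
      refine Finset.sum_congr rfl fun j _ => ?_
      rw [← Complex.normSq_eq_norm_sq, Complex.normSq_apply]
      simp
    rw [h2] at h
    have h3 : ∑ j, ‖ξ j‖ ^ 2 = 0 := by rw [← h]; simp
    funext j
    have h4 := (Finset.sum_eq_zero_iff_of_nonneg fun j _ => by positivity).mp h3 j
      (Finset.mem_univ j)
    simpa using h4
  set e := LinearEquiv.ofInjectiveEndo S hinj with he
  refine ⟨e.symm, -(δ ∘ₗ (e.symm : (ι → ℂ) →ₗ[ℝ] (ι → ℂ))), fun ξ => ?_⟩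
  have hSe : S (e.symm ξ) = ξ := 
    LinearMap.congr_fun (LinearEquiv.ofInjectiveEndo_right_inv S hinj) ξ
  have h := hD (e.symm ξ)
  rw [hSe] at h
  have h2 : displacement ξ = Complex.exp (-(Complex.I * (δ (e.symm ξ) : ℂ))) •
      (U * displacement (e.symm ξ) * star U) := by
    rw [h, smul_smul, ← Complex.exp_add]
    simp
  have hUU := (Unitary.mem_iff.mp hU).1
  rw [h2, mul_smul_comm, smul_mul_assoc]
  congr 1
  · simp
  · calc star U * (U * displacement (e.symm ξ) * star U) * U
        = (star U * U) * displacement (e.symm ξ) * (star U * U) := by simp only [mul_assoc]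
      _ = displacement (e.symm ξ) := by rw [hUU, one_mul, mul_one]

/-- The quadratic form of the Gibbs state as a bundled quadratic form. -/
def thermalForm (ν : κ → ℝ) (β : ℝ) : QuadraticForm ℝ (κ → ℂ) :=
  ∑ j, thermalVar β (ν j) •
    (QuadraticMap.sq.comp (Complex.reLm ∘ₗ LinearMap.proj j) +
      QuadraticMap.sq.comp (Complex.imLm ∘ₗ LinearMap.proj j))

theorem thermalForm_apply (ν : κ → ℝ) (β : ℝ) (ξ : κ → ℂ) :
    thermalForm ν β ξ = thermalSum ν β ξ := by
  rw [thermalForm, thermalSum, _root_.sum_apply]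
  refine Finset.sum_congr rfl fun j _ => ?_
  rw [← Complex.normSq_eq_norm_sq, Complex.normSq_apply]
  simp [mul_add]

/-- The real-linear embedding `ξ ↦ (ξ, 0)`. -/
def inlReal : (ι → ℂ) →ₗ[ℝ] (ι ⊕ κ → ℂ) where
  toFun ξ := Sum.elim ξ 0
  map_add' ξ η := by ext j; cases j <;> simp
  map_smul' c ξ := by ext j; cases j <;> simp

theorem IsDilation.isGaussian {U : Op (ι ⊕ κ)} {ν : κ → ℝ} {β : ℝ} {E : Channel ι ι}
    (hν : ∀ j, 0 < ν j) (hβ : 0 < β) (hU : IsGaussianUnitary U)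
    (h : IsDilation U (gibbs ν β) E) : IsGaussian E := by
  obtain ⟨S, δ, hS⟩ := hU.exists_inverse
  have hσ := gibbs_mem hν hβ
  refine ⟨LinearMap.funLeft ℝ ℂ Sum.inl ∘ₗ S ∘ₗ inlReal,
    (thermalForm ν β).comp (LinearMap.funLeft ℝ ℂ Sum.inr ∘ₗ S ∘ₗ inlReal), δ ∘ₗ inlReal,
    fun T ξ => ?_⟩
  obtain ⟨P, hP⟩ := exists_isTensor T.2 hσ
  rw [h.charFun_eq hσ hP, charFun, mul_assoc, trace_mul_mul (hP.mem_traceClass T.2 hσ), hS,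
    mul_smul_comm, trace_smul]
  have h1 := hP.charFun_eq T.2 hσ (S (Sum.elim ξ 0) ∘ Sum.inl) (S (Sum.elim ξ 0) ∘ Sum.inr)
  rw [Sum.elim_comp_inl_inr, charFun_gibbs hν hβ, charFun] at h1
  rw [h1, QuadraticMap.comp_apply, thermalForm_apply, Complex.exp_add]
  change _ = charFun (T : Op ι) (S (Sum.elim ξ 0) ∘ Sum.inl) *
    (Complex.exp (-(thermalSum ν β (S (Sum.elim ξ 0) ∘ Sum.inr) : ℂ)) *
      Complex.exp (Complex.I * (δ (Sum.elim ξ 0) : ℂ)))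
  rw [thermalSum]
  ring

theorem isTensor_evolution (ω : ι → ℝ) (ν : κ → ℝ) (t : ℝ) :
    IsTensor (evolution (Sum.elim ω ν) t) (evolution ω t) (evolution ν t) := by
  classical
  refine isTensor_of_expVec fun z w => ?_
  rw [evolution_eq_secondQuant, evolution_eq_secondQuant, evolution_eq_secondQuant,
    secondQuant_expVec, secondQuant_expVec, secondQuant_expVec, tmul_expVec]
  congr 1
  funext j
  cases j <;> simp [phase_mulVec]

theorem star_evolution (ω : ι → ℝ) (t : ℝ) : star (evolution ω t) = evolution ω (-t) := by
  classical
  rw [evolution_eq_secondQuant, evolution_eq_secondQuant, star_secondQuant, star_phase]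

theorem evolution_mem_unitary (ω : ι → ℝ) (t : ℝ) : evolution ω t ∈ unitary (Op ι) := by
  classical
  rw [evolution_eq_secondQuant]
  exact secondQuant_mem_unitary _

theorem evolution_apply (ω : ι → ℝ) (t : ℝ) (f : Fock ι) (n : ι → ℕ) :
    evolution ω t f n = Complex.exp (-(Complex.I * t * energy ω n)) * f n := by
  refine diagonal_apply ⟨1, fun k => le_of_eq ?_⟩ f n
  rw [Complex.norm_exp]
  simp

theorem gibbs_apply {ω : ι → ℝ} {β : ℝ} (hω : ∀ j, 0 < ω j) (hβ : 0 < β) (f : Fock ι)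
    (n : ι → ℕ) : gibbs ω β f n =
      (trace (boltzmann ω β))⁻¹ * Real.exp (-(β * energy ω n)) * f n := by
  rw [mul_assoc, ← boltzmann_apply hω hβ]
  rfl

theorem gibbs_mul_evolution {ω : ι → ℝ} {β : ℝ} (hω : ∀ j, 0 < ω j) (hβ : 0 < β) (t : ℝ) :
    gibbs ω β * evolution ω t = evolution ω t * gibbs ω β := by
  refine clm_ext_ket fun n k => ?_
  simp only [mul_apply_eq_comp, evolution_apply, gibbs_apply hω hβ]
  ring

/-- An operator that commutes with all time translations has matrix elements only between number
states of equal energy, so it commutes with the Gibbs state. -/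
theorem gibbs_commute {ω : ι → ℝ} {β : ℝ} (hω : ∀ j, 0 < ω j) (hβ : 0 < β) {U : Op ι}
    (hU : ∀ t : ℝ, U * evolution ω t = evolution ω t * U) :
    U * gibbs ω β = gibbs ω β * U := by
  refine clm_ext_ket fun n k => ?_
  have hket : ∀ n, gibbs ω β (ket n) =
      ((trace (boltzmann ω β))⁻¹ * Real.exp (-(β * energy ω n))) • ket n := by
    intro n
    rw [gibbs, _root_.smul_apply, boltzmann_ket hω hβ, smul_smul]
  simp only [mul_apply_eq_comp, gibbs_apply hω hβ]
  rw [hket, map_smul]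
  change _ * U (ket n) k = _
  by_cases h0 : U (ket n) k = 0
  · rw [h0, mul_zero, mul_zero]
  have hE : energy ω n = energy ω k := by
    by_contra hne
    have hd : energy ω n - energy ω k ≠ 0 := sub_ne_zero.mpr hne
    -- at this time the two phases differ by a sign
    have h1 := congrArg (fun A : Op ι => A (ket n) k) (hU (Real.pi / (energy ω n - energy ω k)))
    simp only [mul_apply_eq_comp, evolution_apply, evolution_ket, map_smul] at h1
    have h2 := mul_right_cancel₀ h0 h1
    have h3 : Complex.exp (Real.pi * Complex.I) = 1 := by
      have h4 := congrArg (fun x => x⁻¹ * Complex.exp (-(Complex.I *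
        ((Real.pi / (energy ω n - energy ω k) : ℝ) : ℂ) * energy ω k))) h2
      simp only [← Complex.exp_neg, ← Complex.exp_add] at h4
      have hd' : (energy ω n - energy ω k : ℂ) ≠ 0 := by exact_mod_cast hd
      convert h4 using 2
      · push_cast
        field_simp
        ring
      · simp
    rw [Complex.exp_pi_mul_I] at h3
    norm_num at h3
  rw [hE]

theorem isTensor_gibbs {ω : ι → ℝ} {ν : κ → ℝ} {β : ℝ} (hω : ∀ j, 0 < ω j) (hν : ∀ j, 0 < ν j)
    (hβ : 0 < β) : IsTensor (gibbs (Sum.elim ω ν) β) (gibbs ω β) (gibbs ν β) := by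
  have hων : ∀ j, 0 < Sum.elim ω ν j := fun j => by cases j <;> simp [hω, hν]
  obtain ⟨P, hP⟩ := exists_isTensor (gibbs_mem hω hβ) (gibbs_mem hν hβ)
  have h : P = gibbs (Sum.elim ω ν) β := by
    refine eq_of_charFun_eq (hP.mem_traceClass (gibbs_mem hω hβ) (gibbs_mem hν hβ))
      (gibbs_mem hων hβ) fun ξ => ?_
    have h1 := hP.charFun_eq (gibbs_mem hω hβ) (gibbs_mem hν hβ) (ξ ∘ Sum.inl) (ξ ∘ Sum.inr)
    rw [Sum.elim_comp_inl_inr] at h1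
    rw [h1, charFun_gibbs hω hβ, charFun_gibbs hν hβ, charFun_gibbs hων hβ, ← Complex.exp_add,
      Fintype.sum_sum_type]
    congr 1
    push_cast
    simp only [Sum.elim_inl, Sum.elim_inr, Function.comp_apply]
    ring
  rwa [← h]

/-- A passive dilation with a Gibbs ancilla is covariant, since time translation of the composite system
factorizes, commutes with the unitary and fixes the ancilla. -/
theorem IsDilation.isCovariant {U : Op (ι ⊕ κ)} {ω : ι → ℝ} {ν : κ → ℝ} {β : ℝ}
    {E : Channel ι ι} (hν : ∀ j, 0 < ν j) (hβ : 0 < β) (hU : IsPassive (Sum.elim ω ν) U)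
    (h : IsDilation U (gibbs ν β) E) : IsCovariant ω ω E := by
  classical
  intro t T
  have hσ := gibbs_mem hν hβ
  obtain ⟨P, hP⟩ := exists_isTensor T.2 hσ
  have hPm := hP.mem_traceClass T.2 hσ
  set V := evolution (Sum.elim ω ν) t with hV
  have hP' : IsTensor (V * P * star V) (conj (evolution ω t) T : Op ι) (gibbs ν β) := by
    intro ψ φ
    have hg : evolution ν t * gibbs ν β * star (evolution ν t) = gibbs ν β := by
      rw [← gibbs_mul_evolution hν hβ, mul_assoc,
        (Unitary.mem_iff.mp (evolution_mem_unitary ν t)).2, mul_one]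
    have h1 : (conj (evolution ω t) T : Op ι) = evolution ω t * T.1 * star (evolution ω t) := rfl
    rw [h1, ← hg, hV, star_evolution, star_evolution, star_evolution]
    simp only [mul_apply_eq_comp]
    rw [isTensor_evolution, hP, isTensor_evolution]
  refine Subtype.ext (eq_of_charFun_eq (Subtype.property _) (Subtype.property _) fun ξ => ?_)
  rw [h.charFun_eq hσ hP', charFun_conj_evolution, h.charFun_eq hσ hP]
  have hUV : U * (V * P * star V) * star U = V * (U * P * star U) * star V := by
    have h2 : star V * star U = star U * star V := by
      rw [← star_mul, ← star_mul, hU.2 t]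
    calc U * (V * P * star V) * star U = (U * V) * P * (star V * star U) := by
          simp only [mul_assoc]
      _ = (V * U) * P * (star U * star V) := by rw [h2, hV, hU.2 t]
      _ = _ := by simp only [mul_assoc]
  rw [hUV]
  have h3 := charFun_conj_evolution (Sum.elim ω ν) t
    ⟨_, mul_mem_traceClass hPm U (star U)⟩ (Sum.elim ξ 0)
  refine h3.trans ?_
  congr 1
  funext j
  cases j <;> simp [phase_mulVec]

theorem IsDilation.map_gibbs {U : Op (ι ⊕ κ)} {ω : ι → ℝ} {ν : κ → ℝ} {β : ℝ}
    {E : Channel ι ι} (hω : ∀ j, 0 < ω j) (hν : ∀ j, 0 < ν j) (hβ : 0 < β)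
    (hU : IsPassive (Sum.elim ω ν) U) (h : IsDilation U (gibbs ν β) E) :
    E.map ⟨gibbs ω β, gibbs_mem hω hβ⟩ = ⟨gibbs ω β, gibbs_mem hω hβ⟩ := by
  have hων : ∀ j, 0 < Sum.elim ω ν j := fun j => by cases j <;> simp [hω, hν]
  have hP := isTensor_gibbs hω hν hβ
  refine Subtype.ext (eq_of_charFun_eq (Subtype.property _) (Subtype.property _) fun ξ => ?_)
  rw [h.charFun_eq (gibbs_mem hν hβ) hP, gibbs_commute hων hβ hU.2, mul_assoc,
    (Unitary.mem_iff.mp hU.1.1).2, mul_one, charFun_gibbs hων hβ, charFun_gibbs hω hβ,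
    Fintype.sum_sum_type]
  simp

theorem GTO_subset_GEnTO {ω : ι → ℝ} {β : ℝ} (hω : ∀ j, 0 < ω j) (hβ : 0 < β) :
    GTO ω β ⊆ GEnTO ω β := by
  rintro E ⟨r, ν, U, hν, hU, h⟩
  exact ⟨⟨h.isGaussian hν hβ hU.1, h.isCovariant hν hβ hU⟩, _, rfl, h.map_gibbs hω hν hβ hU⟩

end Thermal

/-! ### Structure of enhanced thermal operations -/

section Structure

variable {ι κ : Type} [Fintype ι] [Fintype κ]

open Matrix

theorem charFun_ketBra_expVec (z w ξ : ι → ℂ) :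
    charFun (ketBra (expVec z) (expVec w) : Op ι) ξ =
      Complex.exp (-(star ξ ⬝ᵥ ξ) / 2 - star ξ ⬝ᵥ z + star w ⬝ᵥ ξ + star w ⬝ᵥ z) := by
  rw [charFun, trace_ketBra_mul, inner_displacement]

/-- The characteristic functions of the operators `|e(z)⟩⟨e(0)|` separate points, even up to a
common factor. -/
theorem eq_of_charFun_mul_eq {a b : ι → ℂ} {g g' : ℂ} (hg : g ≠ 0)
    (h : ∀ T : traceClass ι, charFun (T : Op ι) a * g = charFun (T : Op ι) b * g') : a = b := by
  have h1 : ∀ z, Complex.exp (-(star a ⬝ᵥ a) / 2 - star a ⬝ᵥ z) * g =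
      Complex.exp (-(star b ⬝ᵥ b) / 2 - star b ⬝ᵥ z) * g' := fun z => by
    simpa [charFun_ketBra_expVec] using h (ketBra (expVec z) (expVec 0))
  have h2 := h1 0
  have h3 := h1 (a - b)
  simp only [dotProduct_zero, sub_zero] at h2
  rw [sub_eq_add_neg (-(star a ⬝ᵥ a) / 2), sub_eq_add_neg (-(star b ⬝ᵥ b) / 2), Complex.exp_add,
    Complex.exp_add, mul_right_comm, h2, mul_right_comm _ _ g'] at h3
  have hne : Complex.exp (-(star b ⬝ᵥ b) / 2) * g' ≠ 0 := by
    rw [← h2]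
    exact mul_ne_zero (Complex.exp_ne_zero _) hg
  have h4 := mul_left_cancel₀ hne h3
  have h5 : star (a - b) ⬝ᵥ (a - b) = ((∑ j, ‖(a - b) j‖ ^ 2 : ℝ) : ℂ) := (sum_norm_sq_eq _).symm
  have h6 : Complex.exp (star (a - b) ⬝ᵥ (a - b)) = 1 := by
    rw [star_sub, sub_dotProduct, sub_eq_add_neg, Complex.exp_add, ← neg_neg (star a ⬝ᵥ (a - b)),
      Complex.exp_neg, h4, ← Complex.exp_neg, neg_neg, ← Complex.exp_add, add_neg_cancel,
      Complex.exp_zero]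
  rw [h5, ← Complex.ofReal_exp, Complex.ofReal_eq_one, Real.exp_eq_one_iff] at h6
  funext j
  have h7 := (Finset.sum_eq_zero_iff_of_nonneg fun j _ => by positivity).mp h6 j
    (Finset.mem_univ j)
  exact sub_eq_zero.mp (by simpa using h7)

theorem le_of_cos_eq {a b : ℝ} (ha : 0 < a) (hb : 0 < b)
    (h : ∀ t : ℝ, Real.cos (t * a) = Real.cos (t * b)) : b ≤ a := by
  by_contra! hlt
  have h1 := h (Real.pi / b)
  rw [div_mul_cancel₀ _ hb.ne', Real.cos_pi] at h1
  have h2 : Real.pi / b * a < Real.pi := by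
    rw [div_mul_eq_mul_div, div_lt_iff₀ hb]
    exact mul_lt_mul_of_pos_left hlt Real.pi_pos
  have h3 := Real.cos_lt_cos_of_nonneg_of_le_pi (by positivity) le_rfl h2
  rw [Real.cos_pi] at h3
  linarith

/-- A real-linear map `ℂ → ℂ` that intertwines rotations of two positive frequencies is
complex-linear, and it vanishes unless the frequencies agree. -/
theorem complexLinear_of_intertwines {a b : ℝ} (ha : 0 < a) (hb : 0 < b) (f : ℂ →ₗ[ℝ] ℂ)
    (h : ∀ (t : ℝ) (c : ℂ), f (Complex.exp (-(Complex.I * t * b)) * c) =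
      Complex.exp (-(Complex.I * t * a)) * f c) :
    (∀ c, f c = f 1 * c) ∧ (f 1 ≠ 0 → a = b) := by
  have hab : ∀ c, f c ≠ 0 → a = b := by
    intro c hc
    have hcos : ∀ (t x : ℝ), Complex.exp (-(Complex.I * t * x)) +
        Complex.exp (-(Complex.I * (-t : ℝ) * x)) = ((2 * Real.cos (t * x) : ℝ) : ℂ) := by
      intro t x
      push_cast
      rw [Complex.two_cos, add_comm]
      congr 2 <;> ring
    have h1 : ∀ t : ℝ, Real.cos (t * a) = Real.cos (t * b) := by
      intro t
      have h2 := congrArg₂ (· + ·) (h t c) (h (-t) c)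
      simp only [← map_add, ← add_mul, hcos] at h2
      rw [← Complex.real_smul, map_smul, Complex.real_smul] at h2
      have h3 := mul_right_cancel₀ hc h2
      have h4 : 2 * Real.cos (t * b) = 2 * Real.cos (t * a) := by exact_mod_cast h3
      linarith
    exact le_antisymm (le_of_cos_eq hb ha fun t => (h1 t).symm) (le_of_cos_eq ha hb h1)
  refine ⟨fun c => ?_, hab 1⟩
  by_cases hf : a = b
  · subst hf
    have h1 := h (-(Real.pi / 2) / a) 1
    have h2 : Complex.exp (-(Complex.I * ((-(Real.pi / 2) / a : ℝ) : ℂ) * a)) = Complex.I := by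
      have ha' : (a : ℂ) ≠ 0 := by exact_mod_cast ha.ne'
      refine Eq.trans (congrArg Complex.exp ?_) Complex.exp_pi_div_two_mul_I
      push_cast
      field_simp
    rw [h2, mul_one] at h1
    have h3 : c = c.re • (1 : ℂ) + c.im • Complex.I := by
      simp [Complex.re_add_im]
    rw [h3, map_add, map_smul, map_smul, h1]
    simp only [Complex.real_smul]
    ring
  · have h0 : ∀ c, f c = 0 := fun c => by_contra fun hc => hf (hab c hc)
    rw [h0, h0, zero_mul]

/-- A real-linear map that commutes with the free rotations of the modes is a resonant complex
matrix. -/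
theorem exists_matrix_of_intertwines [DecidableEq ι] {ω : ι → ℝ} (hω : ∀ j, 0 < ω j)
    (K : (ι → ℂ) →ₗ[ℝ] (ι → ℂ))
    (hK : ∀ (t : ℝ) (ξ : ι → ℂ), K ((phase ω t : Matrix ι ι ℂ) *ᵥ ξ) =
      (phase ω t : Matrix ι ι ℂ) *ᵥ K ξ) :
    ∃ M : Matrix ι ι ℂ, Resonant ω M ∧ ∀ ξ, K ξ = M *ᵥ ξ := by
  let f : ι → ι → ℂ →ₗ[ℝ] ℂ := fun i j =>
    LinearMap.proj i ∘ₗ K ∘ₗ LinearMap.single ℝ (fun _ : ι => ℂ) j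
  have hf : ∀ i j, (∀ c, f i j c = f i j 1 * c) ∧ (f i j 1 ≠ 0 → ω i = ω j) := by
    intro i j
    refine complexLinear_of_intertwines (hω i) (hω j) _ fun t c => ?_
    have h1 := congrFun (hK t (Pi.single j c)) i
    rw [phase_mulVec] at h1
    have h2 : (phase ω t : Matrix ι ι ℂ) *ᵥ Pi.single j c =
        Pi.single j (Complex.exp (-(Complex.I * t * ω j)) * c) := by
      funext k
      rw [phase_mulVec]
      rcases eq_or_ne k j with rfl | hk
      · simp
      · simp [hk]
    rw [h2] at h1
    exact h1
  refine ⟨Matrix.of fun i j => f i j 1, fun i j h => (hf i j).2 h, fun ξ => ?_⟩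
  funext i
  have h3 : ξ = ∑ j, Pi.single j (ξ j) := (Finset.univ_sum_single ξ).symm
  conv_lhs => rw [h3, map_sum, Finset.sum_apply]
  exact Finset.sum_congr rfl fun j _ => (hf i j).1 (ξ j)

theorem Channel.inner_map_ketBra_nonneg {ι κ : Type} (E : Channel ι κ) (ψ : Fock ι) (x : Fock κ) :
    0 ≤ ⟪x, (E.map (ketBra ψ ψ) : Op κ) x⟫_ℂ := by
  have h := E.completelyPositive 1 (fun _ _ => ketBra ψ ψ) (fun v => by
    have h1 : ⟪v 0, (ketBra ψ ψ : Op ι) (v 0)⟫_ℂ = ((‖⟪ψ, v 0⟫_ℂ‖ ^ 2 : ℝ) : ℂ) := by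
      change ⟪v 0, ⟪ψ, v 0⟫_ℂ • ψ⟫_ℂ = _
      rw [inner_smul_right, ← inner_conj_symm (v 0) ψ, Complex.mul_conj']
      push_cast
      rfl
    simp only [Fin.sum_univ_one, h1]
    exact Complex.zero_le_real.mpr (sq_nonneg _)) (fun _ => x)
  simpa using h

/-- A positive trace-preserving map sends `|ψ⟩⟨ψ|` to an operator whose characteristic function is
bounded by `‖ψ‖²`. -/
theorem Channel.norm_charFun_le {ι κ : Type} [Fintype κ] (E : Channel ι κ) (ψ : Fock ι) (ξ : κ → ℂ) :
    ‖charFun (E.map (ketBra ψ ψ) : Op κ) ξ‖ ≤ ‖ψ‖ ^ 2 := by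
  refine (norm_trace_mul_le (E.map (ketBra ψ ψ)).2 (E.inner_map_ketBra_nonneg ψ)
    (displacement_mem_unitary ξ)).trans_eq ?_
  have h := trace_ketBra_mul ψ ψ 1
  rw [mul_one] at h
  rw [E.tracePreserving, h]
  exact inner_self_eq_norm_sq (𝕜 := ℂ) ψ

/-- The superposition `∑_{k < n} D(k η) |0⟩`, an approximate eigenvector of `D(η)`. -/
def comb (η : ι → ℂ) (n : ℕ) : Fock ι :=
  ∑ k ∈ Finset.range n, displacement ((k : ℂ) • η) (expVec 0)

theorem displacement_comb (η : ι → ℂ) (n : ℕ) : displacement η (comb η n) =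
    comb η n + (displacement ((n : ℂ) • η) (expVec 0) - expVec 0) := by
  have h1 : ∀ k : ℕ, displacement η (displacement ((k : ℂ) • η) (expVec 0)) =
      displacement (((k + 1 : ℕ) : ℂ) • η) (expVec 0) := by
    intro k
    rw [← mul_apply_eq_comp, displacement_mul]
    have h2 : star ((k : ℂ) • η) ⬝ᵥ η - star η ⬝ᵥ ((k : ℂ) • η) = 0 := by
      rw [star_smul, smul_dotProduct, dotProduct_smul]
      simp
    have h3 : η + (k : ℂ) • η = ((k + 1 : ℕ) : ℂ) • η := by
      rw [Nat.cast_add, Nat.cast_one, add_smul, one_smul, add_comm]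
    rw [h2, h3]
    simp
  have h0 : displacement (((0 : ℕ) : ℂ) • η) (expVec 0) = expVec (0 : ι → ℂ) := by
    rw [Nat.cast_zero, zero_smul, displacement_zero]
    rfl
  rw [comb, map_sum, Finset.sum_congr rfl fun k _ => h1 k]
  have h4 := (Finset.sum_range_succ (fun k : ℕ => displacement ((k : ℂ) • η) (expVec 0)) n).symm.trans
    (Finset.sum_range_succ' (fun k : ℕ => displacement ((k : ℂ) • η) (expVec 0)) n)
  rw [h0] at h4
  rw [← add_sub_assoc, h4, add_sub_cancel_right]

theorem norm_displacement (ξ : ι → ℂ) (ψ : Fock ι) : ‖displacement ξ ψ‖ = ‖ψ‖ :=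
  Unitary.norm_map (⟨_, displacement_mem_unitary ξ⟩ : unitary (Op ι)) ψ

theorem norm_expVec_zero : ‖expVec (0 : ι → ℂ)‖ = 1 := by
  have h := inner_self_eq_norm_sq (𝕜 := ℂ) (expVec (0 : ι → ℂ))
  rw [inner_expVec_dotProduct, dotProduct_zero, Complex.exp_zero] at h
  have h2 : ‖expVec (0 : ι → ℂ)‖ ^ 2 = 1 ^ 2 := by rw [← h]; simp
  exact (sq_eq_sq₀ (norm_nonneg _) zero_le_one).mp h2

theorem le_norm_comb_sq (η : ι → ℂ) (n : ℕ) : (n : ℝ) ≤ ‖comb η n‖ ^ 2 := by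
  -- the overlaps of coherent states on a real line are positive
  have h1 : ∀ k l : ℕ, 0 ≤ (⟪displacement ((k : ℂ) • η) (expVec 0),
      displacement ((l : ℂ) • η) (expVec 0)⟫_ℂ).re := by
    intro k l
    have h2 : ⟪displacement ((k : ℂ) • η) (expVec 0), displacement ((l : ℂ) • η) (expVec 0)⟫_ℂ =
        Complex.exp ((-(((k : ℝ) - l) ^ 2 / 2 * ∑ j, ‖η j‖ ^ 2) : ℝ) : ℂ) := by
      rw [displacement_expVec_dotProduct, displacement_expVec_dotProduct, inner_smul_left,
        inner_smul_right, inner_expVec_dotProduct, ← Complex.exp_conj, ← Complex.exp_add,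
        ← Complex.exp_add]
      congr 1
      simp only [Complex.ofReal_neg, Complex.ofReal_mul, sum_norm_sq_eq]
      simp only [zero_add, dotProduct_zero, sub_zero, star_smul, smul_dotProduct, dotProduct_smul,
        map_div₀, map_neg, Complex.conj_ofNat, smul_eq_mul, map_mul, conj_dotProduct]
      simp
      ring
    rw [h2, ← Complex.ofReal_exp, Complex.ofReal_re]
    exact (Real.exp_pos _).le
  have h3 : ‖comb η n‖ ^ 2 = ∑ k ∈ Finset.range n, ∑ l ∈ Finset.range n,
      (⟪displacement ((k : ℂ) • η) (expVec 0), displacement ((l : ℂ) • η) (expVec 0)⟫_ℂ).re := by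
    have h4 := (inner_self_eq_norm_sq (𝕜 := ℂ) (comb η n)).symm
    rw [h4, comb, sum_inner, map_sum]
    refine Finset.sum_congr rfl fun k _ => ?_
    rw [inner_sum, map_sum]
    rfl
  rw [h3]
  calc (n : ℝ) = ∑ _k ∈ Finset.range n, (1 : ℝ) := by simp
    _ ≤ _ := Finset.sum_le_sum fun k hk => by
      refine le_trans (le_of_eq ?_) (Finset.single_le_sum (fun l _ => h1 k l) hk)
      have h5 := inner_self_eq_norm_sq (𝕜 := ℂ) (displacement ((k : ℂ) • η) (expVec 0))
      rw [norm_displacement, norm_expVec_zero, one_pow] at h5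
      exact h5.symm

/-- If a channel acts at one point of phase space as `χ(ξ) ↦ χ(η) e^{-r}`, then `r ≥ 0`: otherwise
the approximate eigenvectors of `D(η)` would be mapped to states with a characteristic function of
modulus greater than one. -/
theorem Channel.nonneg_of_charFun (E : Channel ι κ) {ξ : κ → ℂ} {η : ι → ℂ} {r : ℝ}
    (h : ∀ T, charFun (E.map T : Op κ) ξ = charFun (T : Op ι) η * Complex.exp (-(r : ℂ))) :
    0 ≤ r := by
  by_contra! hr
  have hc : 0 < 1 - Real.exp r := sub_pos.mpr (Real.exp_lt_one_iff.mpr hr)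
  -- `‖ψₙ‖² (1 - e^r) ≤ 2 ‖ψₙ‖` and `n ≤ ‖ψₙ‖²` are incompatible for this `n`
  obtain ⟨n, hn⟩ := exists_nat_gt ((2 / (1 - Real.exp r)) ^ 2)
  set ψ := comb η n with hψ
  have h1 := E.norm_charFun_le ψ ξ
  rw [h, norm_mul, charFun, trace_ketBra_mul, hψ, displacement_comb, ← hψ, inner_add_right] at h1
  have h2 : ‖Complex.exp (-(r : ℂ))‖ = Real.exp (-r) := by
    rw [Complex.norm_exp]; simp
  rw [h2] at h1
  set d := displacement ((n : ℂ) • η) (expVec 0) - expVec 0 with hd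
  have h3 : ‖d‖ ≤ 2 := by
    refine (norm_sub_le _ _).trans_eq ?_
    rw [norm_displacement, norm_expVec_zero]
    norm_num
  have h4 : ‖ψ‖ ^ 2 - ‖ψ‖ * 2 ≤ ‖⟪ψ, ψ⟫_ℂ + ⟪ψ, d⟫_ℂ‖ := by
    have h5 : ‖⟪ψ, ψ⟫_ℂ‖ = ‖ψ‖ ^ 2 := by rw [inner_self_eq_norm_sq_to_K]; simp
    have h6 : ‖⟪ψ, d⟫_ℂ‖ ≤ ‖ψ‖ * 2 :=
      (norm_inner_le_norm _ _).trans (mul_le_mul_of_nonneg_left h3 (norm_nonneg _))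
    have h7 := norm_sub_le_norm_add ⟪ψ, ψ⟫_ℂ ⟪ψ, d⟫_ℂ
    linarith
  have h8 : ‖ψ‖ ^ 2 - ‖ψ‖ * 2 ≤ ‖ψ‖ ^ 2 * Real.exp r := by
    have h9 := mul_le_mul_of_nonneg_right (mul_le_mul_of_nonneg_right h4 (Real.exp_pos (-r)).le
      |>.trans h1) (Real.exp_pos r).le
    rwa [mul_assoc, ← Real.exp_add, neg_add_cancel, Real.exp_zero, mul_one] at h9
  have h10 : (2 / (1 - Real.exp r)) ^ 2 < ‖ψ‖ ^ 2 := hn.trans_le (le_norm_comb_sq η n)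
  have h11 : 2 / (1 - Real.exp r) < ‖ψ‖ := lt_of_pow_lt_pow_left₀ 2 (norm_nonneg _) h10
  rw [div_lt_iff₀ hc] at h11
  have h12 : 0 < ‖ψ‖ := by
    refine lt_of_le_of_ne (norm_nonneg _) fun h0 => ?_
    rw [← h0, zero_mul] at h11
    linarith
  nlinarith

/-- The standard form of an enhanced thermal operation: a resonant matrix acting on displacements,
with a noise term that is dictated by the preservation of the Gibbs state and is nonnegative because
the channel is positive. -/
theorem exists_matrix_of_mem_GEnTO [DecidableEq ι] {ω : ι → ℝ} {β : ℝ} (hω : ∀ j, 0 < ω j)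
    (hβ : 0 < β) {E : Channel ι ι} (hE : E ∈ GEnTO ω β) :
    ∃ M : Matrix ι ι ℂ, Resonant ω M ∧ (∀ ξ, thermalSum ω β (M *ᵥ ξ) ≤ thermalSum ω β ξ) ∧
      ∀ (T : traceClass ι) (ξ : ι → ℂ), charFun (E.map T : Op ι) ξ = charFun (T : Op ι) (M *ᵥ ξ) *
        Complex.exp (-((thermalSum ω β ξ - thermalSum ω β (M *ᵥ ξ) : ℝ) : ℂ)) := by
  obtain ⟨⟨⟨K, q, δ, hK⟩, hcov⟩, γ, hγ, hEγ⟩ := hE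
  have hphase : ∀ (t : ℝ) (ξ : ι → ℂ), K ((phase ω t : Matrix ι ι ℂ) *ᵥ ξ) =
      (phase ω t : Matrix ι ι ℂ) *ᵥ K ξ := by
    intro t ξ
    set ξ' := (phase ω t : Matrix ι ι ℂ) *ᵥ ξ with hξ'
    refine (eq_of_charFun_mul_eq (Complex.exp_ne_zero (-(q ξ : ℂ) + Complex.I * (δ ξ : ℂ)))
      (g' := Complex.exp (-(q ξ' : ℂ) + Complex.I * (δ ξ' : ℂ))) fun T => ?_).symm
    have h1 := hK (conj (evolution ω (-t)) T) ξ
    rw [hcov, charFun_conj_evolution, charFun_conj_evolution, neg_neg, hK] at h1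
    exact h1.symm
  obtain ⟨M, hM, hKM⟩ := exists_matrix_of_intertwines hω K hphase
  have hg : ∀ ξ, Complex.exp (-(q ξ : ℂ) + Complex.I * (δ ξ : ℂ)) =
      Complex.exp (-((thermalSum ω β ξ - thermalSum ω β (M *ᵥ ξ) : ℝ) : ℂ)) := by
    intro ξ
    have h1 := hK γ ξ
    rw [hEγ, hγ, hKM, charFun_gibbs hω hβ, charFun_gibbs hω hβ] at h1
    refine mul_left_cancel₀ (Complex.exp_ne_zero _) (h1.symm.trans ?_)
    rw [← Complex.exp_add]
    congr 1
    simp only [thermalSum]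
    push_cast
    ring
  have hlaw : ∀ (T : traceClass ι) (ξ : ι → ℂ), charFun (E.map T : Op ι) ξ =
      charFun (T : Op ι) (M *ᵥ ξ) *
        Complex.exp (-((thermalSum ω β ξ - thermalSum ω β (M *ᵥ ξ) : ℝ) : ℂ)) := by
    intro T ξ
    rw [hK, hg, hKM]
  exact ⟨M, hM, fun ξ => sub_nonneg.mp (E.nonneg_of_charFun fun T => hlaw T ξ), hlaw⟩

end Structure

/-! ### Beam-splitter decomposition and dilation -/

section Decomposition

variable {ι : Type} [Fintype ι] [DecidableEq ι]

open Matrix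

/-- The channel `T ↦ U E(W T W†) U†` for unitaries `U`, `W`. -/
def Channel.conjugate (E : Channel ι ι) {U W : Op ι} (hU : U ∈ unitary (Op ι))
    (hW : W ∈ unitary (Op ι)) : Channel ι ι where
  map :=
    { toFun := fun T => conj U (E.map (conj W T))
      map_add' := fun S T => by
        have hadd : ∀ (V : Op ι) (S T : traceClass ι), conj V (S + T) = conj V S + conj V T :=
          fun V S T => Subtype.ext (by
            change V * (S.1 + T.1) * star V = V * S.1 * star V + V * T.1 * star V
            rw [mul_add, add_mul])
        rw [hadd, map_add, hadd]
      map_smul' := fun c T => by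
        have hsmul : ∀ (V : Op ι) (T : traceClass ι), conj V (c • T) = c • conj V T :=
          fun V T => Subtype.ext (by
            change V * (c • T.1) * star V = c • (V * T.1 * star V)
            rw [mul_smul_comm, smul_mul_assoc])
        rw [hsmul, map_smul, hsmul]
        rfl }
  completelyPositive := by
    have hpos : ∀ (V : Op ι) (k : ℕ) (T : Fin k → Fin k → traceClass ι),
        BlockPositive (fun i j => (T i j : Op ι)) →
        BlockPositive (fun i j => (conj V (T i j) : Op ι)) := by
      intro V k T hT v
      refine (hT fun i => star V (v i)).trans_eq
        (Finset.sum_congr rfl fun i _ => Finset.sum_congr rfl fun j _ => ?_)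
      change _ = ⟪v i, V ((T i j : Op ι) (star V (v j)))⟫_ℂ
      rw [ContinuousLinearMap.star_eq_adjoint, ContinuousLinearMap.adjoint_inner_left]
    exact fun k T hT => hpos U k _ (E.completelyPositive k _ (hpos W k T hT))
  tracePreserving := by
    have htr : ∀ {V : Op ι}, V ∈ unitary (Op ι) → ∀ T : traceClass ι,
        trace (conj V T : Op ι) = trace (T : Op ι) := by
      intro V hV T
      change trace (V * T.1 * star V) = _
      rw [trace_mul_mul T.2, (Unitary.mem_iff.mp hV).1, mul_one]
    exact fun T => (htr hU _).trans ((E.tracePreserving _).trans (htr hW T))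

theorem resonant_star_coe {ω : ι → ℝ} {V : unitaryGroup ι ℂ}
    (hV : Resonant ω (V : Matrix ι ι ℂ)) : Resonant ω ((star V : unitaryGroup ι ℂ) : Matrix ι ι ℂ) :=
  hV.star

/-- The singular value decomposition of the matrix of an enhanced thermal operation: the singular
values are at most one, since they are the amplitudes by which the channel damps normal modes. -/
theorem exists_svd_of_mem_GEnTO {ω : ι → ℝ} {β : ℝ} (hω : ∀ j, 0 < ω j) (hβ : 0 < β)
    {E : Channel ι ι} (hE : E ∈ GEnTO ω β) :
    ∃ (A B : unitaryGroup ι ℂ) (s : ι → ℝ), (∀ j, 0 ≤ s j ∧ s j ≤ 1) ∧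
      Resonant ω (A : Matrix ι ι ℂ) ∧ Resonant ω (B : Matrix ι ι ℂ) ∧
      ∀ (T : traceClass ι) (ξ : ι → ℂ), charFun (E.map T : Op ι) ξ =
        charFun (T : Op ι) ((A : Matrix ι ι ℂ) *ᵥ fun i => (s i : ℂ) * ((B : Matrix ι ι ℂ) *ᵥ ξ) i) *
        Complex.exp (-((thermalSum ω β ((B : Matrix ι ι ℂ) *ᵥ ξ) -
          thermalSum ω β (fun i => (s i : ℂ) * ((B : Matrix ι ι ℂ) *ᵥ ξ) i) : ℝ) : ℂ)) := by
  obtain ⟨M, hM, hle, hlaw⟩ := exists_matrix_of_mem_GEnTO hω hβ hE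
  obtain ⟨A, B, s, hs, hA, hB, hMAB⟩ := hM.exists_svd
  have hMξ : ∀ ξ, M *ᵥ ξ =
      (A : Matrix ι ι ℂ) *ᵥ fun i => (s i : ℂ) * ((B : Matrix ι ι ℂ) *ᵥ ξ) i := by
    intro ξ
    rw [hMAB, ← mulVec_mulVec, ← mulVec_mulVec]
    congr 1
    funext i
    rw [mulVec_diagonal]
  have hle' : ∀ ξ, thermalSum ω β (fun i => (s i : ℂ) * ((B : Matrix ι ι ℂ) *ᵥ ξ) i) ≤
      thermalSum ω β ((B : Matrix ι ι ℂ) *ᵥ ξ) := by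
    intro ξ
    rw [← thermalSum_mulVec hA, ← hMξ, thermalSum_mulVec hB]
    exact hle ξ
  refine ⟨A, B, s, fun j => ⟨hs j, ?_⟩, hA, hB, fun T ξ => ?_⟩
  · have h := hle' ((star B : Matrix ι ι ℂ) *ᵥ Pi.single j 1)
    rw [mulVec_mulVec, mem_unitaryGroup_iff.mp B.2, one_mulVec] at h
    have h1 : ∀ c : ι → ℂ, thermalSum ω β (fun i => c i * (Pi.single j 1 : ι → ℂ) i) =
        thermalVar β (ω j) * ‖c j‖ ^ 2 := by
      intro c
      rw [thermalSum, Finset.sum_eq_single j]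
      · simp
      · intro i _ hi
        simp [hi]
      · simp
    have h2 := h1 1
    simp only [Pi.one_apply, one_mul, norm_one, one_pow, mul_one] at h2
    rw [h1, h2, Complex.norm_real, Real.norm_eq_abs, sq_abs] at h
    have h3 := thermalVar_pos hβ (hω j)
    have h4 : s j ^ 2 ≤ 1 := by
      by_contra! h5
      have := mul_lt_mul_of_pos_left h5 h3
      linarith
    exact (sq_le_one_iff₀ (hs j)).mp h4
  · rw [hlaw, hMξ, thermalSum_mulVec hA, thermalSum_mulVec hB]

/-- An enhanced thermal operation is dilated by one ancilla mode per system mode: rotate with `A†`,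
mix each mode with its ancilla on a beam splitter, and rotate with `B†`. A mode with singular value
one does not couple to its ancilla. -/
theorem exists_dilation_of_mem_GEnTO {ω : ι → ℝ} {β : ℝ} (hω : ∀ j, 0 < ω j) (hβ : 0 < β)
    {E : Channel ι ι} (hE : E ∈ GEnTO ω β) :
    ∃ U : Op (ι ⊕ ι), IsPassive (Sum.elim ω ω) U ∧ IsDilation U (gibbs ω β) E := by
  obtain ⟨A, B, s, hs, hA, hB, hlaw⟩ := exists_svd_of_mem_GEnTO hω hβ hE
  set c : ι → ℝ := fun i => Real.sqrt (1 - s i ^ 2) with hc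
  have hsc : ∀ i, s i ^ 2 + c i ^ 2 = 1 := fun i => by
    have := (sq_le_one_iff₀ (hs i).1).mpr (hs i).2
    rw [hc, Real.sq_sqrt (sub_nonneg.mpr this)]
    ring
  have hc0 : ∀ i, i ∉ Set.range (id : ι → ι) → c i = 0 := fun i hi => absurd ⟨i, rfl⟩ hi
  have hid : Function.Injective (id : ι → ι) := Function.injective_id
  set X : unitaryGroup (ι ⊕ ι) ℂ := ⟨_, mixer_mem_unitaryGroup hid hc0 hsc⟩ with hX
  set V : unitaryGroup (ι ⊕ ι) ℂ := inlUnitary ι (star B) * X * inlUnitary ι (star A) with hV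
  refine ⟨secondQuant V, isPassive_secondQuant ?_, isDilation_secondQuant V (gibbs_mem hω hβ) E
    fun T ξ => ?_⟩
  · exact (((resonant_star_coe hB).inlUnitary ω).mul (resonant_mixer id s c ω)).mul
      ((resonant_star_coe hA).inlUnitary ω)
  · have h1 : (star V : Matrix (ι ⊕ ι) (ι ⊕ ι) ℂ) *ᵥ Sum.elim ξ 0 =
        Sum.elim ((A : Matrix ι ι ℂ) *ᵥ fun i => (s i : ℂ) * ((B : Matrix ι ι ℂ) *ᵥ ξ) i)
          (fun i => (c i : ℂ) * ((B : Matrix ι ι ℂ) *ᵥ ξ) i) := by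
      have h2 : (star V : Matrix (ι ⊕ ι) (ι ⊕ ι) ℂ) =
          (star (inlUnitary ι (star A)) : Matrix _ _ ℂ) * ((star (mixer id s c) : Matrix _ _ ℂ) *
            (star (inlUnitary ι (star B)) : Matrix _ _ ℂ)) := by
        rw [← star_mul, ← star_mul]
        rfl
      have h3 := star_mixer_mulVec (p := (id : ι → ι)) s c ((B : Matrix ι ι ℂ) *ᵥ ξ)
      rw [h2, ← mulVec_mulVec, ← mulVec_mulVec, star_inlUnitary_mulVec]
      simp only [Unitary.coe_star, star_star]
      rw [h3, star_inlUnitary_mulVec]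
      simp
    rw [h1, Sum.elim_comp_inl, Sum.elim_comp_inr, hlaw, charFun_gibbs hω hβ]
    have h4 := thermalSum_mixer hid hc0 hsc ω β ((B : Matrix ι ι ℂ) *ᵥ ξ)
    rw [← h4]
    rfl

/-- Only the modes with singular value less than one need a beam splitter. -/
theorem isThermalNetwork_of_mem_GEnTO {ω : ι → ℝ} {β : ℝ} (hω : ∀ j, 0 < ω j) (hβ : 0 < β)
    {E : Channel ι ι} (hE : E ∈ GEnTO ω β) : IsThermalNetwork ω β E := by
  classical
  obtain ⟨A, B, s, hs, hA, hB, hlaw⟩ := exists_svd_of_mem_GEnTO hω hβ hE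
  set J : Finset ι := Finset.univ.filter fun i => s i < 1 with hJ
  have hmem : ∀ i, i ∈ J ↔ s i < 1 := fun i => by simp [hJ]
  set c : ι → ℝ := fun i => if i ∈ J then Real.sqrt (1 - s i ^ 2) else 0 with hc
  have hs' : (fun i => if i ∈ J then Real.sqrt (s i ^ 2) else 1) = s := by
    funext i
    split_ifs with h
    · exact Real.sqrt_sq (hs i).1
    · exact le_antisymm (not_lt.mp fun h' => h ((hmem i).mpr h')) (hs i).2
  have hsc : ∀ i, s i ^ 2 + c i ^ 2 = 1 := by
    intro i
    simp only [hc]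
    split_ifs with h
    · rw [Real.sq_sqrt (sub_nonneg.mpr ((sq_le_one_iff₀ (hs i).1).mpr (hs i).2))]
      ring
    · rw [le_antisymm (hs i).2 (not_lt.mp fun h' => h ((hmem i).mpr h'))]
      norm_num
  have hc0 : ∀ i, i ∉ Set.range (fun j : J => (j : ι)) → c i = 0 := fun i hi =>
    if_neg fun h => hi ⟨⟨i, h⟩, rfl⟩
  have hinj : Function.Injective (fun j : J => (j : ι)) := Subtype.val_injective
  have hmix : beamSplitter J (fun i => s i ^ 2) = mixer (fun j : J => (j : ι)) s c := by
    rw [beamSplitter_eq_mixer, hs']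
  set X : unitaryGroup (ι ⊕ J) ℂ := ⟨_, mixer_mem_unitaryGroup hinj hc0 hsc⟩ with hX
  have hν : ∀ j : J, 0 < ω j := fun j => hω j
  refine ⟨J, fun i => s i ^ 2, secondQuant (star B), secondQuant (star A), secondQuant X,
    -- `E_D` is `E` with the two passive rotations undone, hence a channel without further proof
    E.conjugate (secondQuant_mem_unitary B) (secondQuant_mem_unitary A), fun j hj => ?_,
    isPassive_secondQuant (resonant_star_coe hB), isPassive_secondQuant (resonant_star_coe hA),
    isPassive_secondQuant (resonant_mixer _ s c ω), ?_,
    isDilation_secondQuant X (gibbs_mem hν hβ) _ fun T ξ => ?_, fun T => ?_⟩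
  · exact ⟨sq_nonneg _, (sq_lt_one_iff₀ (hs j).1).mpr ((hmem j).mp hj)⟩
  · rw [hmix]
    exact implements_secondQuant X
  · have h1 := star_mixer_mulVec (p := fun j : J => (j : ι)) s c ξ
    have h2 : (star X : Matrix (ι ⊕ J) (ι ⊕ J) ℂ) *ᵥ Sum.elim ξ 0 = _ := h1
    have h3 := thermalSum_mixer hinj hc0 hsc ω β ξ
    have h4 : charFun (conj (secondQuant B) (E.map (conj (secondQuant A) T)) : Op ι) ξ = _ :=
      charFun_conj_secondQuant B _ ξ
    rw [h2, Sum.elim_comp_inl, Sum.elim_comp_inr, charFun_gibbs hν hβ]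
    refine h4.trans ?_
    rw [hlaw, charFun_conj_secondQuant, mulVec_mulVec, mulVec_mulVec, UnitaryGroup.star_mul_self,
      mem_unitaryGroup_iff.mp B.2, one_mulVec, one_mulVec, ← h3]
    rfl
  · change _ = conj (secondQuant (star B)) (conj (secondQuant B)
      (E.map (conj (secondQuant A) (conj (secondQuant (star A)) T))))
    rw [conj_conj, conj_conj, secondQuant_mul, secondQuant_mul, Unitary.star_mul_self,
      Unitary.mul_star_self, secondQuant_one, conj_one, conj_one]

end Decomposition

end

end GaussianThermo

open GaussianThermo in
theorem theorem2 {m : ℕ} (ω : Fin m → ℝ) (hω : ∀ j, 0 < ω j) (β : ℝ) (hβ : 0 < β) :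
    (∀ E ∈ GEnTO ω β, ∃ (r : ℕ) (ν : Fin r → ℝ) (U : Op (Fin m ⊕ Fin r)),
      (∀ j, 0 < ν j) ∧ IsPassive (Sum.elim ω ν) U ∧ IsDilation U (gibbs ν β) E) ∧
    GEnTO ω β = GTO ω β ∧
    ∀ E ∈ GEnTO ω β, IsThermalNetwork ω β E := by
  have h : ∀ E ∈ GEnTO ω β, ∃ (r : ℕ) (ν : Fin r → ℝ) (U : Op (Fin m ⊕ Fin r)),
      (∀ j, 0 < ν j) ∧ IsPassive (Sum.elim ω ν) U ∧ IsDilation U (gibbs ν β) E := by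
    intro E hE
    obtain ⟨U, hU, hd⟩ := exists_dilation_of_mem_GEnTO hω hβ hE
    exact ⟨m, ω, U, hω, hU, hd⟩
  exact ⟨h, Set.Subset.antisymm h (GTO_subset_GEnTO hω hβ),
    fun E hE => isThermalNetwork_of_mem_GEnTO hω hβ hE⟩
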